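/- Let $\Lambda$ be a row-finite $k$-graph with no sources, that is, a nonempty countable small category with a degree functor $d:\Lambda\to\mathbb N^k$ having the unique factorisation property, such that the set $v\Lambda^n$ of elements of degree $n$ with range $v$ is finite and nonempty for all $v\in\Lambda^0$, $n\in\mathbb N^k$. Let $\mathbb T$ be the circle group and let $\phi:Q_2(\Lambda)\to\mathbb T$ be a cubical $2$-cocycle, where $Q_2(\Lambda)$ is the set of $2$-cubes (elements of degree $e_i+e_j$, $i<j$); that is, for every $\lambda$ of degree $e_{i_1}+e_{i_2}+e_{i_3}$ with $i_1<i_2<i_3$, $$\phi(F_3^0(\lambda))\,\phi(F_2^1(\lambda))\,\phi(F_1^0(\lambda))=\phi(F_1^1(\lambda))\,\phi(F_2^0(\lambda))\,\phi(F_3^1(\lambda)),$$ where $\lambda=F_j^0(\lambda)\beta=\alpha F_j^1(\lambda)$ with $d(\alpha)=d(\beta)=e_{i_j}$. A Cuntz–Krieger $\phi$-representation in a $C^*$-algebra $B$ consists of mutually orthogonal projections $p_v$ ($v\in\Lambda^0$) and elements $s_\lambda$ ($\lambda\in\bigcup_i\Lambda^{e_i}$) of $B$ with (i) $s_\lambda^*s_\lambda=p_{s(\lambda)}$;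 (ii) $s_{\nu'}s_{\mu'}=\phi(\mu\nu)s_\mu s_\nu$ whenever $\mu\nu=\nu'\mu'$ with $d(\mu)=d(\mu')=e_i$, $d(\nu)=d(\nu')=e_j$, $i<j$; (iii) $p_v=\sum_{\lambda\in v\Lambda^{e_i}}s_\lambda s_\lambda^*$ whenever $v\Lambda^{e_i}\neq\emptyset$. Let $C^*_\phi(\Lambda)$ be the universal $C^*$-algebra generated by such a representation $(p,s)$: for every Cuntz–Krieger $\phi$-representation $(p',s')$ in a $C^*$-algebra $B$ there is a unique $*$-homomorphism $C^*_\phi(\Lambda)\to B$ with $p_v\mapsto p'_v$ and $s_\lambda\mapsto s'_\lambda$. For $\lambda\in\Lambda$ let $\overline\lambda=\overline\lambda_1\cdots\overline\lambda_{|\lambda|}$ be its preferred factorisation, the unique factorisation into edges (elements of degree $e_1,\dots,e_k$) in which edges of degree $e_1$ come first, then those of degree $e_2$, and so on. For a composable sequence $w$ of edges, let $S_\phi(w)\in\mathbb T$ be the product of the values $\phi(fg)$ over the steps of any procedure that turns $w$ into the preferred factorisation of its product by successively replacing two adjacent edges $g'f'$ with $d(g')=e_j$, $d(f')=e_i$,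 $i<j$, by the edges $fg$ with $fg=g'f'$, $d(f)=e_i$, $d(g)=e_j$. Put $c_\phi(\mu,\nu):=S_\phi(\overline\mu\,\overline\nu)$ for composable $\mu,\nu$. A categorical $\mathbb T$-valued $2$-cocycle on $\Lambda$ is a function $c$ on composable pairs with $c(\mu,\nu)=1$ if $\mu$ or $\nu$ is a vertex, and $c(\lambda_1,\lambda_2)c(\lambda_1\lambda_2,\lambda_3)=c(\lambda_2,\lambda_3)c(\lambda_1,\lambda_2\lambda_3)$ for composable triples. For such $c$, a Cuntz–Krieger $(\Lambda,c)$-family in a $C^*$-algebra $B$ is a map $t:\Lambda\to B$ such that the $t_v$, $v\in\Lambda^0$, are mutually orthogonal projections, $t_\mu t_\nu=c(\mu,\nu)t_{\mu\nu}$ whenever $s(\mu)=r(\nu)$, $t_\lambda^*t_\lambda=t_{s(\lambda)}$ for all $\lambda\in\Lambda$, and $t_v=\sum_{\lambda\in v\Lambda^n}t_\lambda t_\lambda^*$ for all $v\in\Lambda^0$, $n\in\mathbb N^k$. Let $C^*(\Lambda,c)$ be the universal $C^*$-algebra generated by such a family $s^c$. Then $c_\phi$ is a categorical $2$-cocycle.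 Set $t_v:=p_v$ for $v\in\Lambda^0$ and $t_\lambda:=s_{\overline\lambda_1}\cdots s_{\overline\lambda_{|\lambda|}}$ for $\lambda\in\Lambda\setminus\Lambda^0$. Then: 1. $t$ is a Cuntz–Krieger $(\Lambda,c_\phi)$-family in $C^*_\phi(\Lambda)$. 2. This family is universal: for every Cuntz–Krieger $(\Lambda,c_\phi)$-family $t'$ in a $C^*$-algebra $B$ there is a unique $*$-homomorphism $\pi:C^*_\phi(\Lambda)\to B$ with $\pi(t_\lambda)=t'_\lambda$ for all $\lambda\in\Lambda$. Consequently there is an isomorphism $C^*(\Lambda,c_\phi)\cong C^*_\phi(\Lambda)$ carrying $s^{c_\phi}_\lambda$ to $t_\lambda$ for all $\lambda\in\Lambda$. 3. If a categorical $2$-cocycle $c$ is cohomologous to $c_\phi$, say $c(\mu,\nu)=b(\mu)b(\nu)\overline{b(\mu\nu)}\,c_\phi(\mu,\nu)$ for all composable $\mu,\nu$, with $b:\Lambda\to\mathbb T$ equal to $1$ on $\Lambda^0$, then there is an isomorphism $C^*(\Lambda,c)\cong C^*_\phi(\Lambda)$ carrying $s^c_\lambda$ to $b(\lambda)t_\lambda$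 for all $\lambda\in\Lambda$. -/

import Mathlib

open CategoryTheory
open scoped ENNReal

universe u w

/-- A `k`-graph: a nonempty countable small category with a degree functor to `ℕ^k` that has the
factorisation property.  `V` is the set of vertices (objects).  A morphism `f : v ⟶ w` stands for
the element of the `k`-graph with range `v` and source `w`, so that the product `μν`, defined when
`s(μ) = r(ν)`, is `μ ≫ ν`; the vertex `v`, as an element of degree `0`, is `𝟙 v`. -/
class KGraph (k : outParam ℕ) (V : Type u) [SmallCategory V] where
  nonempty : Nonempty V
  countable : Countable (Σ v w : V, v ⟶ w)
  degree : ∀ {v w : V}, (v ⟶ w) → (Fin k → ℕ)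
  degree_id : ∀ v : V, degree (𝟙 v) = 0
  degree_comp : ∀ {a b c : V} (f : a ⟶ b) (g : b ⟶ c), degree (f ≫ g) = degree f + degree g
  factorisation : ∀ {v w : V} (f : v ⟶ w) (m n : Fin k → ℕ), degree f = m + n →
    ∃! x : Σ a : V, (v ⟶ a) × (a ⟶ w),
      degree x.2.1 = m ∧ degree x.2.2 = n ∧ x.2.1 ≫ x.2.2 = f

namespace KGraph

variable {k : ℕ} {V : Type u} [SmallCategory V] [KGraph k V]

variable (V) in
/-- Each vertex receives only finitely many elements of each degree. -/
def RowFinite : Prop :=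
  ∀ (v : V) (n : Fin k → ℕ), Finite {x : Σ w : V, (v ⟶ w) // degree x.2 = n}

variable (V) in
/-- Each vertex receives at least one element of each degree. -/
def NoSources : Prop :=
  ∀ (v : V) (n : Fin k → ℕ), Nonempty {x : Σ w : V, (v ⟶ w) // degree x.2 = n}

/-- The factorisation `f = μν` with `d(μ) = m` and `d(ν) = n`. -/
noncomputable def factor {v w : V} (f : v ⟶ w) (m n : Fin k → ℕ) (h : degree f = m + n) :
    Σ a : V, (v ⟶ a) × (a ⟶ w) :=
  (factorisation f m n h).choose

theorem factor_spec {v w : V} (f : v ⟶ w) (m n : Fin k → ℕ) (h : degree f = m + n) :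
    degree (factor f m n h).2.1 = m ∧ degree (factor f m n h).2.2 = n ∧
      (factor f m n h).2.1 ≫ (factor f m n h).2.2 = f :=
  (factorisation f m n h).choose_spec.1

/-! ### Cubical cochains -/

variable (V) in
/-- The set `Q_r` of `r`-cubes: elements `hom` with `d(hom) ≤ (1, …, 1)` and `|hom| = r`. -/
structure Cube (r : ℕ) where
  {rng src : V}
  hom : rng ⟶ src
  le_one : ∀ i, degree hom i ≤ 1
  sum_eq : ∑ i, degree hom i = r

/-- The directions of a cube: the `i` such that the generator `e_i` occurs in its degree. -/
abbrev Cube.Dir {r : ℕ} (x : Cube V r) : Type := {i : Fin k // degree x.hom i = 1}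

theorem Cube.degree_sub_add {r : ℕ} (x : Cube V r) (i : x.Dir) :
    degree x.hom = (degree x.hom - Pi.single i.1 1) + Pi.single i.1 1 := by
  funext j
  by_cases hj : j = i.1
  · subst hj
    simp [i.2]
  · simp [hj]

theorem Cube.le_one_of_degree {r : ℕ} (x : Cube V r) (i : x.Dir) {v w : V} (f : v ⟶ w)
    (h : degree f = degree x.hom - Pi.single i.1 1) (j : Fin k) : degree f j ≤ 1 := by
  rw [h]
  exact (Nat.sub_le _ _).trans (x.le_one j)

theorem Cube.sum_of_degree {r : ℕ} (x : Cube V (r + 1)) (i : x.Dir) {v w : V} (f : v ⟶ w)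
    (h : degree f = degree x.hom - Pi.single i.1 1) : ∑ j, degree f j = r := by
  have h1 := x.sum_eq
  rw [x.degree_sub_add i, ← h] at h1
  simpa [Finset.sum_add_distrib] using h1

/-- The face `F_i^0(x) = x(0, d(x) - e_i)`, indexed by the direction `i` itself. -/
noncomputable def Cube.face0 {r : ℕ} (x : Cube V (r + 1)) (i : x.Dir) : Cube V r where
  hom := (factor x.hom (degree x.hom - Pi.single i.1 1) (Pi.single i.1 1) (x.degree_sub_add i)).2.1
  le_one := x.le_one_of_degree i _ (factor_spec _ _ _ _).1
  sum_eq := x.sum_of_degree i _ (factor_spec _ _ _ _).1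

/-- The face `F_i^1(x) = x(e_i, d(x))`, indexed by the direction `i` itself. -/
noncomputable def Cube.face1 {r : ℕ} (x : Cube V (r + 1)) (i : x.Dir) : Cube V r where
  hom := (factor x.hom (Pi.single i.1 1) (degree x.hom - Pi.single i.1 1)
    ((x.degree_sub_add i).trans (add_comm _ _))).2.2
  le_one := x.le_one_of_degree i _ (factor_spec _ _ _ _).2.1
  sum_eq := x.sum_of_degree i _ (factor_spec _ _ _ _).2.1

/-- The position `j` (counted from `1`) of the direction `i = i_j` in the increasing list
`i_1 < … < i_r` of all directions of the cube. -/
def Cube.position {r : ℕ} (x : Cube V r) (i : x.Dir) : ℕ :=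
  (Finset.univ.filter fun j : x.Dir => j.1 ≤ i.1).card

/-- The cubical coboundary `δ^r`, for coefficients in a multiplicatively written abelian group:
`(δ f)(x) = ∏_j f(F_j^0(x))^((-1)^j) * f(F_j^1(x))^((-1)^(j+1))`. -/
noncomputable def cubicalCoboundary {A : Type*} [CommGroup A] {r : ℕ} (f : Cube V r → A)
    (x : Cube V (r + 1)) : A :=
  ∏ i : x.Dir, f (x.face0 i) ^ ((-1 : ℤ) ^ x.position i) *
    f (x.face1 i) ^ ((-1 : ℤ) ^ (x.position i + 1))

/-- Cubical `r`-cocycles. -/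
def IsCubicalCocycle {A : Type*} [CommGroup A] {r : ℕ} (f : Cube V r → A) : Prop :=
  ∀ x : Cube V (r + 1), cubicalCoboundary f x = 1

/-! ### Categorical cochains -/

variable (V) in
/-- Functions on the elements of the `k`-graph. -/
abbrev Fun1 (A : Type*) := ∀ ⦃a b : V⦄, (a ⟶ b) → A

variable (V) in
/-- Functions on the composable pairs of the `k`-graph. -/
abbrev Fun2 (A : Type*) := ∀ ⦃a b c : V⦄, (a ⟶ b) → (b ⟶ c) → A

/-- Normalised categorical `1`-cochains. -/
def IsCochain1 {A : Type*} [CommGroup A] (b : Fun1 V A) : Prop :=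
  ∀ v : V, b (𝟙 v) = 1

/-- The categorical coboundary `δ^1`, written multiplicatively. -/
def coboundary1 {A : Type*} [CommGroup A] (b : Fun1 V A) : Fun2 V A :=
  fun _ _ _ μ ν => b ν * (b (μ ≫ ν))⁻¹ * b μ

/-- Normalised categorical `2`-cochains. -/
def IsCochain2 {A : Type*} [CommGroup A] (c : Fun2 V A) : Prop :=
  ∀ ⦃v w : V⦄ (f : v ⟶ w), c (𝟙 v) f = 1 ∧ c f (𝟙 w) = 1

/-- The categorical coboundary `δ^2`, written multiplicatively. -/
def coboundary2 {A : Type*} [CommGroup A] (c : Fun2 V A) {x₀ x₁ x₂ x₃ : V}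
    (f : x₀ ⟶ x₁) (g : x₁ ⟶ x₂) (h : x₂ ⟶ x₃) : A :=
  c g h * (c (f ≫ g) h)⁻¹ * c f (g ≫ h) * (c f g)⁻¹

/-- Categorical `2`-cocycles. -/
def IsCatCocycle2 {A : Type*} [CommGroup A] (c : Fun2 V A) : Prop :=
  IsCochain2 c ∧ ∀ ⦃x₀ x₁ x₂ x₃ : V⦄ (f : x₀ ⟶ x₁) (g : x₁ ⟶ x₂) (h : x₂ ⟶ x₃),
    coboundary2 c f g h = 1

/-! ### The skeleton and edge factorisations -/

/-- An edge with range `v` and source `w`, together with its colour. -/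
structure Edge (v w : V) where
  colour : Fin k
  hom : v ⟶ w
  degree_hom : degree hom = Pi.single colour 1

/-- The elements of the path category of the skeleton (the directed graph whose arrows are the
edges of the `k`-graph).  A path `u_1 ⋯ u_n` is listed from its range to its source: `snoc` appends
an edge at the source end. -/
inductive EdgePath (a : V) : V → Type u
  | nil : EdgePath a a
  | snoc {b c : V} (p : EdgePath a b) (e : Edge b c) : EdgePath a c

/-- Concatenation of paths. -/
def EdgePath.comp {a b : V} (p : EdgePath a b) : ∀ {c : V}, EdgePath b c → EdgePath a c
  | _, EdgePath.nil => p
  | _, EdgePath.snoc q e => EdgePath.snoc (EdgePath.comp p q) e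

/-- The product in the `k`-graph of the edges of a path. -/
def EdgePath.prod {a : V} : ∀ {b : V}, EdgePath a b → (a ⟶ b)
  | _, EdgePath.nil => 𝟙 a
  | _, EdgePath.snoc p e => EdgePath.prod p ≫ Edge.hom e

/-- The sequence of colours of the edges of a path. -/
def EdgePath.colours {a : V} : ∀ {b : V}, EdgePath a b → List (Fin k)
  | _, EdgePath.nil => []
  | _, EdgePath.snoc p e => EdgePath.colours p ++ [Edge.colour e]

/-- The colours of the edges of the path are nondecreasing. -/
def EdgePath.Sorted {a b : V} (p : EdgePath a b) : Prop :=
  p.colours.Pairwise (· ≤ ·)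

/-- Allowable transitions `(u, w)`: the paths `u` and `w` agree except at two consecutive places,
where `u` has edges `f`, `g` with colours increasing, `w` has edges `g'`, `f'` with the colours
interchanged, and `fg = g'f'` in the `k`-graph. -/
inductive Transition : ∀ {a b : V}, EdgePath a b → EdgePath a b → Type u
  | swap {a b c c' d e : V} (x : EdgePath a b) (f : Edge b c) (g : Edge c d)
      (g' : Edge b c') (f' : Edge c' d) (y : EdgePath d e)
      (lt : f.colour < g.colour) (hf : f'.colour = f.colour) (hg : g'.colour = g.colour)
      (eq : f.hom ≫ g.hom = g'.hom ≫ f'.hom) :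
      Transition (EdgePath.comp ((x.snoc f).snoc g) y) (EdgePath.comp ((x.snoc g').snoc f') y)

/-- Paths in the transition graph, with range `u` and source `w`. -/
inductive Shuffle {a b : V} : EdgePath a b → EdgePath a b → Type u
  | nil (w : EdgePath a b) : Shuffle w w
  | cons {u v w : EdgePath a b} (τ : Transition u v) (α : Shuffle v w) : Shuffle u w

/-- The `2`-cube `fg`, for edges `f`, `g` of different colours. -/
def square {a b c : V} (f : Edge a b) (g : Edge b c) (h : f.colour ≠ g.colour) : Cube V 2 where
  hom := f.hom ≫ g.hom
  le_one i := by
    rw [degree_comp, f.degree_hom, g.degree_hom]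
    by_cases h1 : i = f.colour
    · subst h1
      simp [h]
    · by_cases h2 : i = g.colour
      · subst h2
        simp [h1]
      · simp [h1, h2]
  sum_eq := by
    rw [degree_comp, f.degree_hom, g.degree_hom]
    simp [Finset.sum_add_distrib]

/-- The value of `φ` on the square that is flipped by a transition. -/
def Transition.cost {A : Type*} (φ : Cube V 2 → A) :
    ∀ {a b : V} {u w : EdgePath a b}, Transition u w → A
  | _, _, _, _, Transition.swap _ f g _ _ _ lt _ _ _ => φ (square f g lt.ne)

/-- The functorial extension of `Transition.cost` to paths in the transition graph. -/
def Shuffle.cost {A : Type*} [CommGroup A] (φ : Cube V 2 → A) {a b : V} :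
    ∀ {u w : EdgePath a b}, Shuffle u w → A
  | _, _, Shuffle.nil _ => 1
  | _, _, Shuffle.cons τ α => τ.cost φ * α.cost φ

theorem Transition.snoc {a b c : V} {u w : EdgePath a b} (τ : Transition u w) (e : Edge b c) :
    Nonempty (Transition (u.snoc e) (w.snoc e)) := by
  cases τ with
  | swap x f g g' f' y lt hf hg eq =>
    exact ⟨Transition.swap x f g g' f' (y.snoc e) lt hf hg eq⟩

theorem Shuffle.snoc {a b c : V} {u w : EdgePath a b} (α : Shuffle u w) (e : Edge b c) :
    Nonempty (Shuffle (u.snoc e) (w.snoc e)) := by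
  induction α with
  | nil w => exact ⟨Shuffle.nil _⟩
  | cons τ α ih =>
    obtain ⟨τ'⟩ := τ.snoc e
    obtain ⟨α'⟩ := ih
    exact ⟨Shuffle.cons τ' α'⟩

theorem Shuffle.trans {a b : V} {t u w : EdgePath a b} (α : Shuffle t u) (β : Shuffle u w) :
    Nonempty (Shuffle t w) := by
  induction α with
  | nil w => exact ⟨β⟩
  | cons τ α ih =>
    obtain ⟨γ⟩ := ih β
    exact ⟨Shuffle.cons τ γ⟩

theorem EdgePath.prod_comp {a b c : V} (p : EdgePath a b) (q : EdgePath b c) :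
    (p.comp q).prod = p.prod ≫ q.prod := by
  induction q with
  | nil => simp [EdgePath.prod, EdgePath.comp]
  | snoc q e ih => simp [EdgePath.prod, EdgePath.comp, ih]

theorem EdgePath.colours_comp {a b c : V} (p : EdgePath a b) (q : EdgePath b c) :
    (p.comp q).colours = p.colours ++ q.colours := by
  induction q with
  | nil => simp [EdgePath.colours, EdgePath.comp]
  | snoc q e ih => simp [EdgePath.colours, EdgePath.comp, ih]

theorem Transition.prod_eq {a b : V} {u w : EdgePath a b} (τ : Transition u w) :
    u.prod = w.prod := by
  cases τ with
  | swap x f g g' f' y lt hf hg eq =>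
    rw [EdgePath.prod_comp, EdgePath.prod_comp]
    simp [EdgePath.prod, eq]

theorem Transition.perm {a b : V} {u w : EdgePath a b} (τ : Transition u w) :
    u.colours.Perm w.colours := by
  cases τ with
  | swap x f g g' f' y lt hf hg eq =>
    rw [EdgePath.colours_comp, EdgePath.colours_comp]
    refine List.Perm.append_right _ ?_
    simp only [EdgePath.colours, List.append_assoc, hf, hg]
    exact List.Perm.append_left _ (List.Perm.swap _ _ _)

theorem Shuffle.prod_eq {a b : V} {u w : EdgePath a b} (α : Shuffle u w) : u.prod = w.prod := by
  induction α with
  | nil w => rfl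
  | cons τ α ih => exact τ.prod_eq.trans ih

theorem Shuffle.perm {a b : V} {u w : EdgePath a b} (α : Shuffle u w) :
    u.colours.Perm w.colours := by
  induction α with
  | nil w => exact List.Perm.refl _
  | cons τ α ih => exact τ.perm.trans ih

theorem exists_swap {a b c : V} (g' : Edge a b) (f' : Edge b c) :
    ∃ (b' : V) (f : Edge a b') (g : Edge b' c),
      f.colour = f'.colour ∧ g.colour = g'.colour ∧ f.hom ≫ g.hom = g'.hom ≫ f'.hom := by
  have h : degree (g'.hom ≫ f'.hom) = Pi.single f'.colour 1 + Pi.single g'.colour 1 := by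
    rw [degree_comp, g'.degree_hom, f'.degree_hom, add_comm]
  obtain ⟨h1, h2, h3⟩ := factor_spec _ _ _ h
  exact ⟨_, ⟨_, _, h1⟩, ⟨_, _, h2⟩, rfl, rfl, h3⟩

theorem exists_sorted_of_snoc {a b : V} (p : EdgePath a b) (hp : p.Sorted) :
    ∀ {c : V} (e : Edge b c), ∃ u : EdgePath a c, u.Sorted ∧ Nonempty (Shuffle u (p.snoc e)) := by
  induction p with
  | nil => exact fun e => ⟨_, by simp [EdgePath.Sorted, EdgePath.colours], ⟨Shuffle.nil _⟩⟩
  | @snoc b' b q g' ih =>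
    intro c e
    have hp' : (EdgePath.colours q ++ [Edge.colour g']).Pairwise (· ≤ ·) := hp
    rw [List.pairwise_append] at hp'
    obtain ⟨hq, -, hqg⟩ := hp'
    by_cases hle : Edge.colour g' ≤ e.colour
    · refine ⟨_, ?_, ⟨Shuffle.nil _⟩⟩
      change ((EdgePath.colours q ++ [Edge.colour g']) ++ [Edge.colour e]).Pairwise (· ≤ ·)
      rw [List.pairwise_append]
      refine ⟨hp, by simp, ?_⟩
      intro i hi j hj
      rw [List.mem_singleton] at hj
      subst hj
      rcases List.mem_append.1 hi with hi | hi
      · exact (hqg i hi _ (by simp)).trans hle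
      · rw [List.mem_singleton] at hi
        subst hi
        exact hle
    · obtain ⟨d, f, g, hf, hg, heq⟩ := exists_swap (V := V) g' e
      obtain ⟨r, hr, ⟨α⟩⟩ := ih hq f
      obtain ⟨α'⟩ := α.snoc g
      have τ : Transition (EdgePath.snoc (EdgePath.snoc q f) g) (EdgePath.snoc (EdgePath.snoc q g') e) :=
        Transition.swap q f g g' e EdgePath.nil
          (by rw [hf, hg]; exact not_le.1 hle) hf.symm hg.symm heq
      refine ⟨r.snoc g, ?_, α'.trans (Shuffle.cons τ (Shuffle.nil _))⟩
      change (EdgePath.colours r ++ [Edge.colour g]).Pairwise (· ≤ ·)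
      rw [List.pairwise_append]
      refine ⟨hr, by simp, ?_⟩
      intro i hi j hj
      rw [List.mem_singleton] at hj
      subst hj
      have hi' : i ∈ EdgePath.colours q ++ [f.colour] := α.perm.mem_iff.1 hi
      rw [hg]
      rcases List.mem_append.1 hi' with hi' | hi'
      · exact hqg i hi' _ (by simp)
      · rw [List.mem_singleton] at hi'
        subst hi'
        rw [hf]
        exact (not_le.1 hle).le

theorem exists_sorted_shuffle {a b : V} (p : EdgePath a b) :
    ∃ u : EdgePath a b, u.Sorted ∧ Nonempty (Shuffle u p) := by
  induction p with
  | nil => exact ⟨_, by simp [EdgePath.Sorted, EdgePath.colours], ⟨Shuffle.nil _⟩⟩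
  | snoc p e ih =>
    obtain ⟨r, hr, ⟨α⟩⟩ := ih
    obtain ⟨s, hs, ⟨β⟩⟩ := exists_sorted_of_snoc r hr e
    obtain ⟨α'⟩ := α.snoc e
    exact ⟨s, hs, β.trans α'⟩

theorem eq_id_of_degree_eq_zero {v w : V} (f : v ⟶ w) (h : degree f = 0) :
    (⟨w, f⟩ : Σ w : V, (v ⟶ w)) = ⟨v, 𝟙 v⟩ := by
  have key := (factorisation f 0 0 (by simp [h])).unique
    (y₁ := ⟨w, f, 𝟙 w⟩) (y₂ := ⟨v, 𝟙 v, f⟩)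
    ⟨h, degree_id w, Category.comp_id f⟩ ⟨degree_id v, h, Category.id_comp f⟩
  exact congrArg (fun x : Σ a : V, (v ⟶ a) × (a ⟶ w) => (⟨x.1, x.2.1⟩ : Σ w : V, (v ⟶ w))) key

theorem exists_edgePath (n : ℕ) : ∀ {v w : V} (f : v ⟶ w), ∑ i, degree f i = n →
    ∃ p : EdgePath v w, p.prod = f := by
  induction n with
  | zero =>
    intro v w f h
    have h0 : degree f = 0 := by
      funext i
      exact (Finset.sum_eq_zero_iff.1 h) i (Finset.mem_univ i)
    cases eq_id_of_degree_eq_zero f h0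
    exact ⟨EdgePath.nil, rfl⟩
  | succ n ih =>
    intro v w f h
    obtain ⟨i, hi⟩ : ∃ i, degree f i ≠ 0 := by
      by_contra hcon
      push Not at hcon
      simp [hcon] at h
    have hd : degree f = (degree f - Pi.single i 1) + Pi.single i 1 := by
      funext j
      by_cases hj : j = i
      · subst hj
        simp only [Pi.add_apply, Pi.sub_apply, Pi.single_eq_same]
        omega
      · simp [hj]
    obtain ⟨h1, h2, h3⟩ := factor_spec f _ _ hd
    have hsum : ∑ j, degree (factor f _ _ hd).2.1 j = n := by
      rw [hd] at h
      rw [h1]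
      simpa [Finset.sum_add_distrib] using h
    obtain ⟨p, hp⟩ := ih _ hsum
    refine ⟨p.snoc ⟨i, _, h2⟩, ?_⟩
    change p.prod ≫ _ = f
    rw [hp, h3]

theorem EdgePath.degree_prod {a b : V} (p : EdgePath a b) (i : Fin k) :
    degree p.prod i = p.colours.count i := by
  induction p with
  | nil => simp [EdgePath.prod, EdgePath.colours, degree_id]
  | snoc q e ih =>
    simp only [EdgePath.prod, EdgePath.colours, List.count_append]
    rw [degree_comp, Pi.add_apply, ih, Edge.degree_hom e]
    by_cases h : i = Edge.colour e
    · subst h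
      simp
    · simp [h, Ne.symm h]

theorem EdgePath.eq_of_sorted {a b : V} (p q : EdgePath a b) (hp : p.Sorted) (hq : q.Sorted)
    (h : p.prod = q.prod) : p = q := by
  induction p with
  | nil =>
    cases q with
    | nil => rfl
    | snoc q e =>
      have h1 := EdgePath.degree_prod (EdgePath.snoc q e) (Edge.colour e)
      rw [← h] at h1
      simp [EdgePath.prod, EdgePath.colours, degree_id] at h1
  | @snoc b' b p e ih =>
    have hperm : (EdgePath.colours (EdgePath.snoc p e)).Perm q.colours := by
      rw [List.perm_iff_count]
      intro i
      rw [← EdgePath.degree_prod, ← EdgePath.degree_prod, h]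
    have hcol : EdgePath.colours (EdgePath.snoc p e) = q.colours :=
      hperm.eq_of_pairwise (fun _ _ _ _ h1 h2 => le_antisymm h1 h2) hp hq
    cases q with
    | nil => simp [EdgePath.colours] at hcol
    | @snoc b'' _ q e' =>
      simp only [EdgePath.colours] at hcol
      obtain ⟨hc1, hc2⟩ := List.append_inj' hcol rfl
      have hc3 : Edge.colour e = Edge.colour e' := by simpa using hc2
      have hdeg : degree (EdgePath.prod p) = degree (EdgePath.prod q) := by
        funext i
        rw [EdgePath.degree_prod, EdgePath.degree_prod, hc1]
      simp only [EdgePath.prod] at h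
      have key := (factorisation (EdgePath.prod p ≫ Edge.hom e) (degree (EdgePath.prod p))
        (Pi.single (Edge.colour e) 1) (by rw [degree_comp, Edge.degree_hom e])).unique
        (y₁ := ⟨b', EdgePath.prod p, Edge.hom e⟩) (y₂ := ⟨b'', EdgePath.prod q, Edge.hom e'⟩)
        ⟨rfl, Edge.degree_hom e, rfl⟩
        ⟨hdeg.symm, by rw [hc3]; exact Edge.degree_hom e', h.symm⟩
      have hb : b' = b'' := congrArg Sigma.fst key
      subst hb
      have key' := eq_of_heq (Sigma.mk.inj key).2
      have hp' := (List.pairwise_append.1 hp).1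
      have hq' := (List.pairwise_append.1 hq).1
      have hpq := ih q hp' hq' (congrArg Prod.fst key')
      have hee : e = e' := by
        obtain ⟨c1, m1, d1⟩ := e
        obtain ⟨c2, m2, d2⟩ := e'
        have hm : m1 = m2 := congrArg Prod.snd key'
        have hcc : c1 = c2 := hc3
        subst hm hcc
        rfl
      rw [hpq, hee]

theorem exists_preferred {v w : V} (f : v ⟶ w) : ∃ p : EdgePath v w, p.Sorted ∧ p.prod = f := by
  obtain ⟨p, hp⟩ := exists_edgePath _ f rfl
  obtain ⟨u, hu, ⟨α⟩⟩ := exists_sorted_shuffle p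
  exact ⟨u, hu, α.prod_eq.trans hp⟩

/-- The preferred factorisation: the unique edge path with product `f` and nondecreasing
colours (unique by `EdgePath.eq_of_sorted`). -/
noncomputable def preferred {v w : V} (f : v ⟶ w) : EdgePath v w :=
  (exists_preferred f).choose

theorem exists_shuffle_preferred {a b : V} (p : EdgePath a b) :
    Nonempty (Shuffle (preferred p.prod) p) := by
  obtain ⟨u, hu, ⟨α⟩⟩ := exists_sorted_shuffle p
  obtain ⟨h1, h2⟩ := (exists_preferred p.prod).choose_spec
  have : preferred p.prod = u :=
    EdgePath.eq_of_sorted _ _ h1 hu (h2.trans α.prod_eq.symm)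
  rw [this]
  exact ⟨α⟩

/-- The shuffle function `S_φ`: the cost of a path in the transition graph from `p` to the
preferred factorisation of its product.  (If `φ` is a cocycle, all such paths have the same
cost.) -/
noncomputable def shuffleCost {A : Type*} [CommGroup A] (φ : Cube V 2 → A) {a b : V}
    (p : EdgePath a b) : A :=
  (exists_shuffle_preferred p).some.cost φ

/-- The categorical cochain `c_φ(μ, ν) = S_φ(μ̄ ν̄)`. -/
noncomputable def catCocycle {A : Type*} [CommGroup A] (φ : Cube V 2 → A) : Fun2 V A :=
  fun _ _ _ μ ν => shuffleCost φ (EdgePath.comp (preferred μ) (preferred ν))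

/-! ### Representations and families in C⋆-algebras -/

section Families

variable {B : Type*} [NonUnitalCStarAlgebra B]

/-- Cuntz–Krieger `φ`-representations of the `k`-graph (assumed row-finite, so that the sums are
finite) in `B`. -/
structure IsCKRep (φ : Cube V 2 → Circle) (p : V → B)
    (s : ∀ ⦃v w : V⦄, Edge v w → B) : Prop where
  proj : ∀ v, IsStarProjection (p v)
  orthogonal : ∀ v w, v ≠ w → p v * p w = 0
  star_mul : ∀ ⦃v w : V⦄ (e : Edge v w), star (s e) * s e = p w
  twist : ∀ ⦃a b b' c : V⦄ (μ : Edge a b) (ν : Edge b c) (ν' : Edge a b') (μ' : Edge b' c)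
    (h : μ.colour < ν.colour), μ'.colour = μ.colour → ν'.colour = ν.colour →
    μ.hom ≫ ν.hom = ν'.hom ≫ μ'.hom →
    s ν' * s μ' = (φ (square μ ν h.ne) : ℂ) • (s μ * s ν)
  sum_eq : ∀ (v : V) (i : Fin k), Nonempty {e : Σ w : V, Edge v w // e.2.colour = i} →
    p v = ∑ᶠ e : {e : Σ w : V, Edge v w // e.2.colour = i}, s e.1.2 * star (s e.1.2)

/-- Cuntz–Krieger `(Λ, c)`-families (for a row-finite `k`-graph without sources) in `B`. -/
structure IsCKFamily (c : Fun2 V Circle) (t : Fun1 V B) : Prop where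
  proj : ∀ v, IsStarProjection (t (𝟙 v))
  orthogonal : ∀ v w : V, v ≠ w → t (𝟙 v) * t (𝟙 w) = 0
  mul_eq : ∀ ⦃a b d : V⦄ (μ : a ⟶ b) (ν : b ⟶ d), t μ * t ν = (c μ ν : ℂ) • t (μ ≫ ν)
  star_mul : ∀ ⦃v w : V⦄ (f : v ⟶ w), star (t f) * t f = t (𝟙 w)
  sum_eq : ∀ (v : V) (n : Fin k → ℕ),
    t (𝟙 v) = ∑ᶠ x : {x : Σ w : V, (v ⟶ w) // degree x.2 = n}, t x.1.2 * star (t x.1.2)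

theorem norm_le_one_of_star_mul {x q : B} (hq : IsStarProjection q) (h : star x * x = q) :
    ‖x‖ ≤ 1 := by
  have h1 : ‖x‖ * ‖x‖ = ‖q‖ := by rw [← h, CStarRing.norm_star_mul_self]
  have h2 : ‖q‖ ≤ 1 := hq.norm_le
  nlinarith [norm_nonneg x]

/-- The element attached to an edge path: `p_v` for the path of length `0` at `v`, and the product
`s_{u_1} ⋯ s_{u_n}` for a path `u_1 ⋯ u_n` with `n ≥ 1`. -/
def pathProduct (p : V → B) (s : ∀ ⦃v w : V⦄, Edge v w → B) {a : V} :
    ∀ {b : V}, EdgePath a b → B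
  | _, EdgePath.nil => p a
  | _, EdgePath.snoc EdgePath.nil e => s e
  | _, EdgePath.snoc (EdgePath.snoc q f) e =>
      pathProduct p s (EdgePath.snoc q f) * s e

end Families

/-! ### The universal C⋆-algebras

Each universal algebra is the C⋆-algebra generated by the direct sum of all representations: the
closed (non-unital) ⋆-subalgebra, generated by the universal generators, of the `ℓ^∞`-product of the
target algebras over all representations in C⋆-algebras in the universe of the `k`-graph. -/

/-- All Cuntz–Krieger `φ`-representations in C⋆-algebras of the universe of the `k`-graph. -/
structure CKRep (φ : Cube V 2 → Circle) where
  B : Type u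
  [alg : NonUnitalCStarAlgebra B]
  p : V → B
  s : ∀ ⦃v w : V⦄, Edge v w → B
  isRep : IsCKRep φ p s

instance (φ : Cube V 2 → Circle) (ρ : CKRep φ) : NonUnitalCStarAlgebra ρ.B := ρ.alg

/-- All Cuntz–Krieger `(Λ, c)`-families in C⋆-algebras of the universe of the `k`-graph. -/
structure CKFamily (c : Fun2 V Circle) where
  B : Type u
  [alg : NonUnitalCStarAlgebra B]
  t : Fun1 V B
  isFamily : IsCKFamily c t

instance (c : Fun2 V Circle) (ρ : CKFamily c) : NonUnitalCStarAlgebra ρ.B := ρ.alg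

section CubicalAlgebra

variable (φ : Cube V 2 → Circle)

/-- The element `(p_v)_ρ` of the product over all representations. -/
noncomputable def bigVertex (v : V) : lp (fun ρ : CKRep φ => ρ.B) ∞ :=
  ⟨fun ρ => ρ.p v, memℓp_infty ⟨1, by
    rintro _ ⟨ρ, rfl⟩
    exact (ρ.isRep.proj v).norm_le⟩⟩

/-- The element `(s_e)_ρ` of the product over all representations. -/
noncomputable def bigEdge {v w : V} (e : Edge v w) : lp (fun ρ : CKRep φ => ρ.B) ∞ :=
  ⟨fun ρ => ρ.s e, memℓp_infty ⟨1, by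
    rintro _ ⟨ρ, rfl⟩
    exact norm_le_one_of_star_mul (ρ.isRep.proj w) (ρ.isRep.star_mul e)⟩⟩

/-- The set of universal generators. -/
def bigGenerators : Set (lp (fun ρ : CKRep φ => ρ.B) ∞) :=
  {x | (∃ v : V, x = bigVertex φ v) ∨ ∃ (v w : V) (e : Edge v w), x = bigEdge φ e}

/-- `C⋆_φ(Λ)` as a closed subalgebra of the product over all representations. -/
noncomputable def cubicalSubalgebra : NonUnitalStarSubalgebra ℂ (lp (fun ρ : CKRep φ => ρ.B) ∞) :=
  (NonUnitalStarAlgebra.adjoin ℂ (bigGenerators φ)).topologicalClosure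

/-- The universal C⋆-algebra `C⋆_φ(Λ)` generated by a Cuntz–Krieger `φ`-representation. -/
abbrev CubicalAlgebra : Type (u + 1) := cubicalSubalgebra φ

noncomputable instance : NonUnitalCStarAlgebra (CubicalAlgebra φ) :=
  NonUnitalStarSubalgebra.nonUnitalCStarAlgebra (cubicalSubalgebra φ)
    (h_closed := NonUnitalStarSubalgebra.isClosed_topologicalClosure _)

/-- The universal generators `p_v` of `C⋆_φ(Λ)`. -/
noncomputable def univVertex (v : V) : CubicalAlgebra φ :=
  ⟨bigVertex φ v, NonUnitalStarSubalgebra.le_topologicalClosure _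
    (NonUnitalStarAlgebra.subset_adjoin ℂ _ (Or.inl ⟨v, rfl⟩))⟩

/-- The universal generators `s_e` of `C⋆_φ(Λ)`. -/
noncomputable def univEdge ⦃v w : V⦄ (e : Edge v w) : CubicalAlgebra φ :=
  ⟨bigEdge φ e, NonUnitalStarSubalgebra.le_topologicalClosure _
    (NonUnitalStarAlgebra.subset_adjoin ℂ _ (Or.inr ⟨v, w, e, rfl⟩))⟩

/-- The elements `t_λ` of `C⋆_φ(Λ)`: products of the universal generators along preferred
factorisations. -/
noncomputable def univPath : Fun1 V (CubicalAlgebra φ) :=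
  fun _ _ f => pathProduct (univVertex φ) (univEdge φ) (preferred f)

end CubicalAlgebra

section CatAlgebra

variable (c : Fun2 V Circle)

/-- The element `(t_λ)_ρ` of the product over all families. -/
noncomputable def bigElement {v w : V} (f : v ⟶ w) : lp (fun ρ : CKFamily c => ρ.B) ∞ :=
  ⟨fun ρ => ρ.t f, memℓp_infty ⟨1, by
    rintro _ ⟨ρ, rfl⟩
    exact norm_le_one_of_star_mul (ρ.isFamily.proj w) (ρ.isFamily.star_mul f)⟩⟩

/-- `C⋆(Λ, c)` as a closed subalgebra of the product over all families. -/
noncomputable def catSubalgebra : NonUnitalStarSubalgebra ℂ (lp (fun ρ : CKFamily c => ρ.B) ∞) :=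
  (NonUnitalStarAlgebra.adjoin ℂ
    {x | ∃ (v w : V) (f : v ⟶ w), x = bigElement c f}).topologicalClosure

/-- The universal C⋆-algebra `C⋆(Λ, c)` generated by a Cuntz–Krieger `(Λ, c)`-family. -/
abbrev CatAlgebra : Type (u + 1) := catSubalgebra c

noncomputable instance : NonUnitalCStarAlgebra (CatAlgebra c) :=
  NonUnitalStarSubalgebra.nonUnitalCStarAlgebra (catSubalgebra c)
    (h_closed := NonUnitalStarSubalgebra.isClosed_topologicalClosure _)

/-- The universal generating family of `C⋆(Λ, c)`. -/
noncomputable def univElement : Fun1 V (CatAlgebra c) :=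
  fun v w f => ⟨bigElement c f, NonUnitalStarSubalgebra.le_topologicalClosure _
    (NonUnitalStarAlgebra.subset_adjoin ℂ _ ⟨v, w, f, rfl⟩)⟩

end CatAlgebra

end KGraph

namespace KGraph

/-! ### Unique factorisation, faces of 3-cubes, and the cost of sorting an edge path. -/

section Combinatorics

variable {k : ℕ} {V : Type u} [SmallCategory V] [KGraph k V]

/-! The combinatorial heart is that the cost of sorting an edge path does not depend on the
procedure. Sorting by insertion gives a canonical cost, `EdgePath.sortCost`. The cubical cocycle
identity says that the two ways of sorting three edges of strictly decreasing colours cost the same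
(`IsCubicalCocycle.hexagon`); by induction, undoing one transition before sorting changes the
insertion cost exactly by the value of `φ` on the flipped square (`EdgePath.insertCost_transition`,
`Transition.sortCost_eq`). A sorted path costs nothing, so every shuffle from the preferred
factorisation to a path `p` has cost `p.sortCost φ`. The cocycle identity for `c_φ` follows on
sorting a concatenation of three preferred factorisations in two ways, starting with the left pair
or with the right pair.

On the analytic side, relation (ii) says that the product of generators along a path is multiplied
by the cost when the path is shuffled. Hence products along preferred factorisations multiply with
the factor `c_φ`, and the summation relation in degree `n` follows from that for generators by
induction on `|n|` (`IsCKRep.isCKFamily`). Conversely `c_φ` is `1` on a sorted pair of edges and `φ`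
of the square on an unsorted one, so a family restricts to a representation (`IsCKFamily.isCKRep`);
since `c_φ` is also `1` along sorted paths, this restriction determines the family
(`IsCKFamily.eq_pathProduct`). The two notions therefore have the same universal algebra, and
rescaling by `b` handles cohomologous cocycles.

The concrete universal algebras only range over targets in the universe of the graph. Targets in
other universes are reached because the C⋆-algebra generated by a family is small
(`exists_small_hull`). -/

theorem factor_unique {a b b' c : V} {f : a ⟶ b} {g : b ⟶ c} {f' : a ⟶ b'} {g' : b' ⟶ c}
    (h : f ≫ g = f' ≫ g') (hd : degree f = degree f') :
    (⟨b, f, g⟩ : Σ x : V, (a ⟶ x) × (x ⟶ c)) = ⟨b', f', g'⟩ := by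
  have h2 : degree g' = degree g := by
    have h3 := congrArg degree h
    rw [degree_comp, degree_comp, hd] at h3
    exact (add_left_cancel h3).symm
  exact (factorisation (f ≫ g) _ _ (degree_comp f g)).unique
    (y₁ := ⟨b, f, g⟩) (y₂ := ⟨b', f', g'⟩) ⟨rfl, rfl, rfl⟩ ⟨hd.symm, h2, h.symm⟩

/-- The colour is no extra datum: `e_i` determines `i`. -/
theorem Edge.eq_of_hom_eq {a b : V} {e e' : Edge a b} (h : e.hom = e'.hom) : e = e' := by
  obtain ⟨i, f, hf⟩ := e
  obtain ⟨j, f', hf'⟩ := e'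
  obtain rfl : f = f' := h
  have hij : i = j := by
    by_contra hne
    have h1 := congrFun (hf.symm.trans hf') i
    simp [hne] at h1
  subst hij
  rfl

theorem Edge.degree_eq_of_colour_eq {a b c d : V} {e : Edge a b} {e' : Edge c d}
    (h : e.colour = e'.colour) : degree e.hom = degree e'.hom := by
  rw [e.degree_hom, e'.degree_hom, h]

theorem Edge.pair_unique {a b b' c : V} {f : Edge a b} {g : Edge b c} {f' : Edge a b'}
    {g' : Edge b' c} (h : f.hom ≫ g.hom = f'.hom ≫ g'.hom) (hf : f.colour = f'.colour) :
    (⟨b, f, g⟩ : Σ x : V, Edge a x × Edge x c) = ⟨b', f', g'⟩ := by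
  obtain ⟨rfl, h1⟩ := Sigma.mk.inj_iff.1 (factor_unique h (Edge.degree_eq_of_colour_eq hf))
  obtain ⟨h2, h3⟩ := Prod.mk.inj (eq_of_heq h1)
  rw [Edge.eq_of_hom_eq h2, Edge.eq_of_hom_eq h3]

theorem square_congr {a b b' c : V} {f : Edge a b} {g : Edge b c} {f' : Edge a b'}
    {g' : Edge b' c} (h : f.hom ≫ g.hom = f'.hom ≫ g'.hom) (hne : f.colour ≠ g.colour)
    (hne' : f'.colour ≠ g'.colour) : square f g hne = square f' g' hne' := by
  simp only [square, h]

/-! ### The hexagon identity -/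

/-- Unique factorisation only yields an equality of sigma types, because the intermediate vertex
varies with the factorisation. This lemma and the next turn such equalities into equalities of
cubes. -/
theorem Cube.mk_congr_src {r : ℕ} {v w w' : V} {f : v ⟶ w} {f' : v ⟶ w'}
    (h : (⟨w, f⟩ : Σ x : V, (v ⟶ x)) = ⟨w', f'⟩) (h1 : ∀ i, degree f i ≤ 1)
    (h2 : ∑ i, degree f i = r) (h1' : ∀ i, degree f' i ≤ 1) (h2' : ∑ i, degree f' i = r) :
    Cube.mk f h1 h2 = Cube.mk f' h1' h2' := by
  cases h
  rfl

theorem Cube.mk_congr_rng {r : ℕ} {v v' w : V} {f : v ⟶ w} {f' : v' ⟶ w}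
    (h : (⟨v, f⟩ : Σ x : V, (x ⟶ w)) = ⟨v', f'⟩) (h1 : ∀ i, degree f i ≤ 1)
    (h2 : ∑ i, degree f i = r) (h1' : ∀ i, degree f' i ≤ 1) (h2' : ∑ i, degree f' i = r) :
    Cube.mk f h1 h2 = Cube.mk f' h1' h2' := by
  cases h
  rfl

/-- The face and `fg` are initial segments of the same cube and have the same degree, so unique
factorisation identifies them. The companion lemma treats final segments. -/
theorem Cube.face0_eq_square (x : Cube V 3) (i : x.Dir) {b c : V} (f : Edge x.rng b)
    (g : Edge b c) (h : Edge c x.src) (hx : x.hom = (f.hom ≫ g.hom) ≫ h.hom)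
    (hi : h.colour = i.1) (hne : f.colour ≠ g.colour) : x.face0 i = square f g hne := by
  obtain ⟨h1, h2, h3⟩ := factor_spec x.hom _ _ (x.degree_sub_add i)
  have hd : degree x.hom - Pi.single i.1 1 = degree (f.hom ≫ g.hom) := by
    rw [← hi, ← h.degree_hom, congrArg degree hx, degree_comp _ h.hom, add_tsub_cancel_right]
  have key := factor_unique (h3.trans hx) (h1.trans hd)
  exact Cube.mk_congr_src (congrArg (fun z : Σ a : V, (x.rng ⟶ a) × (a ⟶ x.src) =>
    (⟨z.1, z.2.1⟩ : Σ w : V, (x.rng ⟶ w))) key) _ _ _ _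

theorem Cube.face1_eq_square (x : Cube V 3) (i : x.Dir) {b c : V} (f : Edge x.rng b)
    (g : Edge b c) (h : Edge c x.src) (hx : x.hom = f.hom ≫ g.hom ≫ h.hom)
    (hi : f.colour = i.1) (hne : g.colour ≠ h.colour) : x.face1 i = square g h hne := by
  obtain ⟨h1, h2, h3⟩ := factor_spec x.hom _ _ ((x.degree_sub_add i).trans (add_comm _ _))
  have key := factor_unique (h3.trans hx) (h1.trans (by rw [f.degree_hom, hi]))
  exact Cube.mk_congr_rng (congrArg (fun z : Σ a : V, (x.rng ⟶ a) × (a ⟶ x.src) =>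
    (⟨z.1, z.2.2⟩ : Σ w : V, (w ⟶ x.src))) key) _ _ _ _

/-- The `3`-cube `fgh`, for edges of different colours. -/
def cubeOfEdges {a b c d : V} (f : Edge a b) (g : Edge b c) (h : Edge c d)
    (hfg : f.colour ≠ g.colour) (hfh : f.colour ≠ h.colour) (hgh : g.colour ≠ h.colour) :
    Cube V 3 where
  hom := (f.hom ≫ g.hom) ≫ h.hom
  le_one i := by
    rw [degree_comp, degree_comp, f.degree_hom, g.degree_hom, h.degree_hom]
    simp only [Pi.add_apply, Pi.single_apply]
    split_ifs <;> simp_all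
  sum_eq := by
    rw [degree_comp, degree_comp, f.degree_hom, g.degree_hom, h.degree_hom]
    simp [Finset.sum_add_distrib]

/-- The edges `h`, `g'`, `f'` have strictly decreasing colours, and there are two ways of sorting `h
g' f'` into `f₃ g₃ h₂`: swap the first pair first, or the last pair first. The squares flipped on
the way are the six faces of the 3-cube `h g' f'`, and the cocycle identity equates the two
products. -/
theorem IsCubicalCocycle.hexagon {A : Type*} [CommGroup A] {φ : Cube V 2 → A}
    (hφ : IsCubicalCocycle φ) {a b c d b₁ c₁ b₂ c₂ : V}
    {h : Edge a b} {g' : Edge b c} {f' : Edge c d}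
    {g₁ : Edge a b₁} {h₁ : Edge b₁ c} {f₂ : Edge b₁ c₁} {h₂ : Edge c₁ d}
    {f₃ : Edge a b₂} {g₃ : Edge b₂ c₁} {f : Edge b c₂} {g : Edge c₂ d} {h₄ : Edge b₂ c₂}
    (e₁ : h.hom ≫ g'.hom = g₁.hom ≫ h₁.hom) (e₂ : h₁.hom ≫ f'.hom = f₂.hom ≫ h₂.hom)
    (e₃ : g₁.hom ≫ f₂.hom = f₃.hom ≫ g₃.hom) (e₄ : g'.hom ≫ f'.hom = f.hom ≫ g.hom)
    (e₅ : h.hom ≫ f.hom = f₃.hom ≫ h₄.hom)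
    (lt₁ : g₁.colour < h₁.colour) (lt₂ : f₂.colour < h₂.colour) (lt₃ : f₃.colour < g₃.colour)
    (lt₄ : f.colour < g.colour) (lt₅ : f₃.colour < h₄.colour) (lt₆ : g₃.colour < h₂.colour)
    (cf : f'.colour = f₃.colour) (cg : g'.colour = g₃.colour) (ch : h.colour = h₂.colour)
    (cg₁ : g₁.colour = g₃.colour) (cg₀ : g.colour = g₃.colour) :
    φ (square g₁ h₁ lt₁.ne) * φ (square f₂ h₂ lt₂.ne) * φ (square f₃ g₃ lt₃.ne) =
      φ (square f g lt₄.ne) * φ (square f₃ h₄ lt₅.ne) * φ (square g₃ h₂ lt₆.ne) := by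
  have n₁ : h.colour ≠ g'.colour := by rw [ch, cg]; exact lt₆.ne'
  have n₂ : h.colour ≠ f'.colour := by rw [ch, cf]; exact (lt₃.trans lt₆).ne'
  have n₃ : g'.colour ≠ f'.colour := by rw [cg, cf]; exact lt₃.ne'
  let x := cubeOfEdges h g' f' n₁ n₂ n₃
  have hdeg : ∀ i, degree x.hom i = 1 ↔ i = f₃.colour ∨ i = g₃.colour ∨ i = h₂.colour := by
    intro i
    change degree ((h.hom ≫ g'.hom) ≫ f'.hom) i = 1 ↔ _
    rw [degree_comp, degree_comp, f'.degree_hom, g'.degree_hom, h.degree_hom, cf, cg, ch]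
    rw [cf] at n₂ n₃
    rw [cg] at n₁ n₃
    rw [ch] at n₁ n₂
    simp only [Pi.add_apply, Pi.single_apply]
    split_ifs <;> simp_all
  let I : x.Dir := ⟨f₃.colour, (hdeg _).2 (Or.inl rfl)⟩
  let J : x.Dir := ⟨g₃.colour, (hdeg _).2 (Or.inr (Or.inl rfl))⟩
  let L : x.Dir := ⟨h₂.colour, (hdeg _).2 (Or.inr (Or.inr rfl))⟩
  have hIJ : I < J := lt₃
  have hJL : J < L := lt₆
  have hIJ' : I ≠ J := hIJ.ne
  have hJL' : J ≠ L := hJL.ne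
  have hIL' : I ≠ L := (hIJ.trans hJL).ne
  have cases3 : ∀ z : x.Dir, z = I ∨ z = J ∨ z = L := by
    rintro ⟨z, hz⟩
    rcases (hdeg z).1 hz with h | h | h
    · exact Or.inl (Subtype.ext h)
    · exact Or.inr (Or.inl (Subtype.ext h))
    · exact Or.inr (Or.inr (Subtype.ext h))
  have huniv : (Finset.univ : Finset x.Dir) = {I, J, L} := by
    ext z
    simpa using cases3 z
  have pI : x.position I = 1 := by
    have : (Finset.univ.filter fun j : x.Dir => j.1 ≤ I.1) = {I} := by
      ext z
      rcases cases3 z with rfl | rfl | rfl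
      · simp
      · simp [hIJ'.symm, hIJ]
      · simp [hIL'.symm, hIJ.trans hJL]
    rw [Cube.position, this, Finset.card_singleton]
  have pJ : x.position J = 2 := by
    have : (Finset.univ.filter fun j : x.Dir => j.1 ≤ J.1) = {I, J} := by
      ext z
      rcases cases3 z with rfl | rfl | rfl
      · simp [hIJ.le]
      · simp
      · simp [hIL'.symm, hJL'.symm, hJL]
    rw [Cube.position, this, Finset.card_pair hIJ']
  have pL : x.position L = 3 := by
    have : (Finset.univ.filter fun j : x.Dir => j.1 ≤ L.1) = {I, J, L} := by
      ext z
      rcases cases3 z with rfl | rfl | rfl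
      · simp [(hIJ.trans hJL).le]
      · simp [hJL.le]
      · simp
    rw [Cube.position, this, Finset.card_eq_three.2 ⟨I, J, L, hIJ', hIL', hJL', rfl⟩]
  have q₁ : (h.hom ≫ g'.hom) ≫ f'.hom = (g₁.hom ≫ h₁.hom) ≫ f'.hom := by rw [e₁]
  have q₂ : (h.hom ≫ g'.hom) ≫ f'.hom = g₁.hom ≫ f₂.hom ≫ h₂.hom := by
    rw [q₁, Category.assoc, e₂]
  have q₃ : (h.hom ≫ g'.hom) ≫ f'.hom = (f₃.hom ≫ g₃.hom) ≫ h₂.hom := by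
    rw [q₂, ← Category.assoc, e₃]
  have q₄ : (h.hom ≫ g'.hom) ≫ f'.hom = h.hom ≫ f.hom ≫ g.hom := by rw [Category.assoc, e₄]
  have q₅ : (h.hom ≫ g'.hom) ≫ f'.hom = (f₃.hom ≫ h₄.hom) ≫ g.hom := by
    rw [q₄, ← Category.assoc, e₅]
  have fI0 : x.face0 I = square g₁ h₁ lt₁.ne := x.face0_eq_square I g₁ h₁ f' q₁ cf _
  have fJ0 : x.face0 J = square f₃ h₄ lt₅.ne := x.face0_eq_square J f₃ h₄ g q₅ cg₀ _
  have fL0 : x.face0 L = square f₃ g₃ lt₃.ne := x.face0_eq_square L f₃ g₃ h₂ q₃ rfl _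
  have fI1 : x.face1 I = square g₃ h₂ lt₆.ne :=
    x.face1_eq_square I f₃ g₃ h₂ (q₃.trans (Category.assoc _ _ _)) rfl _
  have fJ1 : x.face1 J = square f₂ h₂ lt₂.ne := x.face1_eq_square J g₁ f₂ h₂ q₂ cg₁ _
  have fL1 : x.face1 L = square f g lt₄.ne := x.face1_eq_square L h f g q₄ ch _
  have key := hφ x
  rw [cubicalCoboundary, huniv, Finset.prod_insert (by simp [hIJ', hIL']),
    Finset.prod_pair hJL', pI, pJ, pL, fI0, fJ0, fL0, fI1, fJ1, fL1] at key
  norm_num at key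
  -- The coboundary is the right side divided by the left side, so the quotient has to be inverted
  -- before it is compared with `key`.
  rw [← mul_inv_eq_one, ← inv_eq_one, ← key]
  simp only [mul_inv_rev, inv_inv]
  simp only [mul_comm, mul_left_comm, mul_assoc]

/-! ### Sorting by insertion -/

/-- Insertion of an edge into an edge path: the edge is moved towards the range until the colour
before it is at most its own. -/
noncomputable def EdgePath.insert {a : V} :
    ∀ {b c : V}, EdgePath a b → Edge b c → EdgePath a c
  | _, _, EdgePath.nil, e => EdgePath.nil.snoc e
  | _, _, EdgePath.snoc q g, e =>
      if g.colour ≤ e.colour then (q.snoc g).snoc e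
      else (EdgePath.insert q (exists_swap g e).choose_spec.choose).snoc
        (exists_swap g e).choose_spec.choose_spec.choose

/-- The product of the values of `φ` on the squares flipped by an insertion. -/
noncomputable def EdgePath.insertCost {A : Type*} [CommGroup A] (φ : Cube V 2 → A) {a : V} :
    ∀ {b c : V}, EdgePath a b → Edge b c → A
  | _, _, EdgePath.nil, _ => 1
  | _, _, EdgePath.snoc q g, e =>
      if h : g.colour ≤ e.colour then 1
      else φ (square (exists_swap g e).choose_spec.choose
          (exists_swap g e).choose_spec.choose_spec.choose
          (by
            obtain ⟨h1, h2, -⟩ := (exists_swap g e).choose_spec.choose_spec.choose_spec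
            exact (h1.trans_lt ((not_le.1 h).trans_eq h2.symm)).ne)) *
        EdgePath.insertCost φ q (exists_swap g e).choose_spec.choose

theorem EdgePath.insert_of_le {a b c d : V} (q : EdgePath a b) (g : Edge b c) (e : Edge c d)
    (h : g.colour ≤ e.colour) : (q.snoc g).insert e = (q.snoc g).snoc e := by
  rw [EdgePath.insert, if_pos h]

theorem EdgePath.insertCost_of_le {A : Type*} [CommGroup A] (φ : Cube V 2 → A) {a b c d : V}
    (q : EdgePath a b) (g : Edge b c) (e : Edge c d) (h : g.colour ≤ e.colour) :
    (q.snoc g).insertCost φ e = 1 := by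
  rw [EdgePath.insertCost, dif_pos h]

/-- The definition swaps by an arbitrary choice from `exists_swap`. Unique factorisation makes every
swap equal to the chosen one, so proofs may name the swapped edges. -/
theorem EdgePath.insert_of_swap {a b c d c' : V} (q : EdgePath a b) (g : Edge b c)
    (e : Edge c d) (e' : Edge b c') (g' : Edge c' d) (h : e.colour < g.colour)
    (he : e'.colour = e.colour) (eq : g.hom ≫ e.hom = e'.hom ≫ g'.hom) :
    (q.snoc g).insert e = (q.insert e').snoc g' := by
  rw [EdgePath.insert, if_neg (not_le.2 h)]
  obtain ⟨h1, h2, h3⟩ := (exists_swap g e).choose_spec.choose_spec.choose_spec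
  have key := Edge.pair_unique (h3.trans eq) (h1.trans he.symm)
  exact congrArg (fun z : Σ x : V, Edge b x × Edge x d => (q.insert z.2.1).snoc z.2.2) key

theorem EdgePath.insertCost_of_swap {A : Type*} [CommGroup A] (φ : Cube V 2 → A)
    {a b c d c' : V} (q : EdgePath a b) (g : Edge b c)
    (e : Edge c d) (e' : Edge b c') (g' : Edge c' d) (h : e.colour < g.colour)
    (he : e'.colour = e.colour) (eq : g.hom ≫ e.hom = e'.hom ≫ g'.hom)
    (hne : e'.colour ≠ g'.colour) :
    (q.snoc g).insertCost φ e = φ (square e' g' hne) * q.insertCost φ e' := by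
  rw [EdgePath.insertCost, dif_neg (not_le.2 h)]
  obtain ⟨h1, h2, h3⟩ := (exists_swap g e).choose_spec.choose_spec.choose_spec
  have key := Edge.pair_unique (h3.trans eq) (h1.trans he.symm)
  congr 1
  · exact congrArg φ (square_congr (h3.trans eq) _ _)
  · exact congrArg (fun z : Σ x : V, Edge b x × Edge x d => q.insertCost φ z.2.1) key

theorem EdgePath.prod_insert {a b : V} (q : EdgePath a b) :
    ∀ {c : V} (e : Edge b c), (q.insert e).prod = q.prod ≫ e.hom := by
  induction q with
  | nil => exact fun e => rfl
  | snoc q g ih =>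
    intro c e
    by_cases h : g.colour ≤ e.colour
    · rw [EdgePath.insert_of_le _ _ _ h]
      rfl
    · obtain ⟨d, f, g₂, hf, hg, heq⟩ := exists_swap g e
      rw [EdgePath.insert_of_swap q g e f g₂ (not_le.1 h) hf heq.symm]
      simp only [EdgePath.prod, ih, Category.assoc, heq]

theorem EdgePath.colours_insert {a b : V} (q : EdgePath a b) :
    ∀ {c : V} (e : Edge b c), (q.insert e).colours.Perm (q.colours ++ [e.colour]) := by
  induction q with
  | nil => exact fun e => List.Perm.refl _
  | snoc q g ih =>
    intro c e
    by_cases h : g.colour ≤ e.colour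
    · rw [EdgePath.insert_of_le _ _ _ h]
      exact List.Perm.refl _
    · obtain ⟨d, f, g₂, hf, hg, heq⟩ := exists_swap g e
      rw [EdgePath.insert_of_swap q g e f g₂ (not_le.1 h) hf heq.symm]
      simp only [EdgePath.colours]
      refine ((ih f).append_right _).trans ?_
      rw [hf, hg, List.append_assoc, List.append_assoc]
      exact List.Perm.append_left _ (List.Perm.swap _ _ _)

theorem EdgePath.sorted_snoc {a b c : V} {q : EdgePath a b} {e : Edge b c} :
    (q.snoc e).Sorted ↔ q.Sorted ∧ ∀ i ∈ q.colours, i ≤ e.colour := by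
  simp [EdgePath.Sorted, EdgePath.colours, List.pairwise_append]

theorem EdgePath.Sorted.snoc_snoc {a b c d : V} {q : EdgePath a b} {g : Edge b c} {e : Edge c d}
    (h : (q.snoc g).Sorted) (hle : g.colour ≤ e.colour) : ((q.snoc g).snoc e).Sorted := by
  refine EdgePath.sorted_snoc.2 ⟨h, fun i hi => ?_⟩
  simp only [EdgePath.colours, List.mem_append, List.mem_singleton] at hi
  rcases hi with hi | rfl
  · exact ((EdgePath.sorted_snoc.1 h).2 i hi).trans hle
  · exact hle

theorem EdgePath.Sorted.insert {a b : V} {q : EdgePath a b} (hq : q.Sorted) :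
    ∀ {c : V} (e : Edge b c), (q.insert e).Sorted := by
  induction q with
  | nil => exact fun e => by simp [EdgePath.insert, EdgePath.Sorted, EdgePath.colours]
  | snoc q g ih =>
    intro c e
    by_cases h : g.colour ≤ e.colour
    · rw [EdgePath.insert_of_le _ _ _ h]
      exact hq.snoc_snoc h
    · obtain ⟨d, f, g₂, hf, hg, heq⟩ := exists_swap g e
      rw [EdgePath.insert_of_swap q g e f g₂ (not_le.1 h) hf heq.symm]
      obtain ⟨h1, h2⟩ := EdgePath.sorted_snoc.1 hq
      refine EdgePath.sorted_snoc.2 ⟨ih h1 f, fun i hi => ?_⟩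
      rw [(EdgePath.colours_insert q f).mem_iff, List.mem_append, List.mem_singleton] at hi
      rw [hg]
      rcases hi with hi | rfl
      · exact h2 i hi
      · exact hf.trans_le (not_le.1 h).le

/-- Insertion of two edges into a path: the effect on the cost of interchanging them. -/
theorem EdgePath.insertCost_transition {A : Type*} [CommGroup A] {φ : Cube V 2 → A}
    (hφ : IsCubicalCocycle φ) {a b : V} (q : EdgePath a b) :
    ∀ {c c' d : V} (f : Edge b c) (g : Edge c d) (g' : Edge b c') (f' : Edge c' d)
      (lt : f.colour < g.colour), f'.colour = f.colour → g'.colour = g.colour →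
      f.hom ≫ g.hom = g'.hom ≫ f'.hom →
      q.insertCost φ g' * (q.insert g').insertCost φ f' =
        φ (square f g lt.ne) * (q.insertCost φ f * (q.insert f).insertCost φ g) := by
  induction q with
  | nil =>
    intro c c' d f g g' f' lt hf hg eq
    simp only [EdgePath.insert]
    rw [EdgePath.insertCost_of_le _ _ f g lt.le,
      EdgePath.insertCost_of_swap φ _ g' f' f g (by rw [hf, hg]; exact lt) hf.symm eq.symm lt.ne]
    simp [EdgePath.insertCost]
  | snoc q h ih =>
    intro c c' d f g g' f' lt hf hg eq
    have lt' : f'.colour < g'.colour := by rw [hf, hg]; exact lt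
    -- If `h ≤ g` in colour, `g` stops behind `h` in either order of insertion, so the only extra
    -- flip is that of `g'` and `f'`. Otherwise the colours of `f`, `g`, `h` are strictly
    -- increasing, both edges pass `h`, and the hexagon applies.
    by_cases hj : h.colour ≤ g.colour
    · rw [EdgePath.insertCost_of_le φ q h g' (hg.symm ▸ hj), one_mul,
        EdgePath.insert_of_le q h g' (hg.symm ▸ hj),
        EdgePath.insertCost_of_swap φ _ g' f' f g lt' hf.symm eq.symm lt.ne]
      by_cases hi : h.colour ≤ f.colour
      · rw [EdgePath.insert_of_le q h f hi, EdgePath.insertCost_of_le φ _ f g lt.le, mul_one]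
      · obtain ⟨_, f₁, h₁, hf₁, hh₁, e₁⟩ := exists_swap h f
        rw [EdgePath.insert_of_swap q h f f₁ h₁ (not_le.1 hi) hf₁ e₁.symm,
          EdgePath.insertCost_of_le φ _ h₁ g (hh₁.symm ▸ hj), mul_one]
    · rw [not_le] at hj
      obtain ⟨b₁, g₁, h₁, hg₁, hh₁, e₁⟩ := exists_swap h g'
      obtain ⟨c₁, f₂, h₂, hf₂, hh₂, e₂⟩ := exists_swap h₁ f'
      obtain ⟨b₂, f₃, g₃, hf₃, hg₃, e₃⟩ := exists_swap g₁ f₂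
      obtain ⟨b₄, f₄, h₄, hf₄, hh₄, e₄⟩ := exists_swap h f
      obtain ⟨c₅, g₅, h₅, hg₅, hh₅, e₅⟩ := exists_swap h₄ g
      -- Both orders of passing `h` end in a factorisation of the same element with the same
      -- sequence of colours, so the resulting edges coincide one by one.
      have key : f₃.hom ≫ g₃.hom ≫ h₂.hom = f₄.hom ≫ g₅.hom ≫ h₅.hom := by
        rw [e₅, ← Category.assoc f₄.hom, e₄, Category.assoc, eq, ← Category.assoc h.hom, ← e₁,
          Category.assoc, ← e₂, ← Category.assoc, e₃, Category.assoc]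
      have cf : f₃.colour = f₄.colour := by rw [hf₃, hf₂, hf, hf₄]
      have cg : g₃.colour = g₅.colour := by rw [hg₃, hg₁, hg, hg₅]
      obtain ⟨rfl, hk⟩ := Sigma.mk.inj_iff.1 (factor_unique key (Edge.degree_eq_of_colour_eq cf))
      obtain ⟨hk₁, hk₂⟩ := Prod.mk.inj (eq_of_heq hk)
      obtain rfl := Edge.eq_of_hom_eq hk₁
      obtain ⟨rfl, hk₃⟩ := Sigma.mk.inj_iff.1 (Edge.pair_unique hk₂ cg)
      obtain ⟨rfl, rfl⟩ := Prod.mk.inj (eq_of_heq hk₃)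
      have lt₁ : g₁.colour < h₁.colour := by rw [hg₁, hh₁, hg]; exact hj
      have lt₂ : f₂.colour < h₂.colour := by rw [hf₂, hh₂, hf, hh₁]; exact lt.trans hj
      have lt₃ : f₃.colour < g₃.colour := by rw [hf₃, hf₂, hf, hg₅]; exact lt
      have lt₅ : f₃.colour < h₄.colour := by rw [hf₄, hh₄]; exact lt.trans hj
      have lt₆ : g₃.colour < h₂.colour := by rw [hg₅, hh₅, hh₄]; exact hj
      rw [EdgePath.insertCost_of_swap φ q h g' g₁ h₁ (hg.symm ▸ hj) hg₁ e₁.symm lt₁.ne,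
        EdgePath.insert_of_swap q h g' g₁ h₁ (hg.symm ▸ hj) hg₁ e₁.symm,
        EdgePath.insertCost_of_swap φ _ h₁ f' f₂ h₂ (by rw [hf, hh₁]; exact lt.trans hj) hf₂
          e₂.symm lt₂.ne,
        EdgePath.insertCost_of_swap φ q h f f₃ h₄ (lt.trans hj) hf₄ e₄.symm lt₅.ne,
        EdgePath.insert_of_swap q h f f₃ h₄ (lt.trans hj) hf₄ e₄.symm,
        EdgePath.insertCost_of_swap φ _ h₄ g g₃ h₂ (by rw [hh₄]; exact hj) hg₅ e₅.symm lt₆.ne]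
      have hex := hφ.hexagon e₁.symm e₂.symm e₃.symm eq.symm e₄.symm lt₁ lt₂ lt₃ lt lt₅ lt₆
        (by rw [hf, hf₄]) (by rw [hg, hg₅]) (by rw [hh₅, hh₄]) hg₃.symm hg₅.symm
      -- Past `h`, the pair still to be inserted into `q` is `g₁ f₂` in one order and `f₃ g₃` in the
      -- other, which again differ by a transition.
      have step := ih f₃ g₃ g₁ f₂ lt₃ hf₃.symm hg₃.symm e₃
      calc _ = φ (square g₁ h₁ lt₁.ne) * φ (square f₂ h₂ lt₂.ne) *
            (q.insertCost φ g₁ * (q.insert g₁).insertCost φ f₂) := mul_mul_mul_comm _ _ _ _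
        _ = (φ (square g₁ h₁ lt₁.ne) * φ (square f₂ h₂ lt₂.ne) * φ (square f₃ g₃ lt₃.ne)) *
            (q.insertCost φ f₃ * (q.insert f₃).insertCost φ g₃) := by
          rw [step, ← mul_assoc]
        _ = _ := by
          rw [hex]
          simp only [mul_comm, mul_left_comm, mul_assoc]

/-- The sorted edge path obtained by successive insertions. -/
noncomputable def EdgePath.sort {a : V} : ∀ {b : V}, EdgePath a b → EdgePath a b
  | _, EdgePath.nil => EdgePath.nil
  | _, EdgePath.snoc p e => (EdgePath.sort p).insert e

/-- The cost of sorting by successive insertions. -/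
noncomputable def EdgePath.sortCost {A : Type*} [CommGroup A] (φ : Cube V 2 → A) {a : V} :
    ∀ {b : V}, EdgePath a b → A
  | _, EdgePath.nil => 1
  | _, EdgePath.snoc p e => EdgePath.sortCost φ p * (EdgePath.sort p).insertCost φ e

theorem EdgePath.sorted_nil {a : V} : (EdgePath.nil : EdgePath a a).Sorted := by
  simp [EdgePath.Sorted, EdgePath.colours]

theorem EdgePath.sorted_sort {a b : V} (p : EdgePath a b) : p.sort.Sorted := by
  induction p with
  | nil => exact EdgePath.sorted_nil
  | snoc p e ih => exact ih.insert e

theorem EdgePath.prod_sort {a b : V} (p : EdgePath a b) : p.sort.prod = p.prod := by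
  induction p with
  | nil => rfl
  | snoc p e ih => simp only [EdgePath.sort, EdgePath.prod, EdgePath.prod_insert, ih]

/-- A sorted path is determined by its product. Hence the cost of inserting a further edge after
sorting depends only on the product of the preceding path. -/
theorem EdgePath.sort_congr {a b : V} {p q : EdgePath a b} (h : p.prod = q.prod) :
    p.sort = q.sort :=
  EdgePath.eq_of_sorted _ _ p.sorted_sort q.sorted_sort (by rw [prod_sort, prod_sort, h])

theorem EdgePath.Sorted.sort_eq {a b : V} {p : EdgePath a b} (h : p.Sorted) : p.sort = p :=
  EdgePath.eq_of_sorted _ _ p.sorted_sort h p.prod_sort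

theorem EdgePath.sortCost_of_sorted {A : Type*} [CommGroup A] (φ : Cube V 2 → A) {a b : V}
    {p : EdgePath a b} (h : p.Sorted) : p.sortCost φ = 1 := by
  induction p with
  | nil => rfl
  | snoc p e ih =>
    obtain ⟨h1, h2⟩ := EdgePath.sorted_snoc.1 h
    rw [EdgePath.sortCost, ih h1, h1.sort_eq, one_mul]
    cases p with
    | nil => rfl
    | snoc q g => exact EdgePath.insertCost_of_le φ q g e (h2 _ (by simp [EdgePath.colours]))

/-- The two paths first differ when the swapped pair is inserted, where
`EdgePath.insertCost_transition` gives the factor. Afterwards their sorted forms agree, so the edges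
of `y` contribute equally. -/
theorem Transition.sortCost_eq {A : Type*} [CommGroup A] {φ : Cube V 2 → A}
    (hφ : IsCubicalCocycle φ) {a b : V} {u v : EdgePath a b} (τ : Transition u v) :
    v.sortCost φ = τ.cost φ * u.sortCost φ := by
  cases τ with
  | swap x f g g' f' y lt hf hg eq =>
    simp only [Transition.cost]
    induction y with
    | nil =>
      simp only [EdgePath.comp, EdgePath.sortCost, EdgePath.sort]
      rw [mul_assoc, EdgePath.insertCost_transition hφ x.sort f g g' f' lt hf hg eq, mul_assoc,
        mul_left_comm]
    | snoc y e ih =>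
      have hsort : (EdgePath.comp ((x.snoc f).snoc g) y).sort =
          (EdgePath.comp ((x.snoc g').snoc f') y).sort :=
        EdgePath.sort_congr (Transition.swap x f g g' f' y lt hf hg eq).prod_eq
      simp only [EdgePath.comp, EdgePath.sortCost]
      rw [ih, hsort, mul_assoc]

theorem Shuffle.sortCost_eq {A : Type*} [CommGroup A] {φ : Cube V 2 → A}
    (hφ : IsCubicalCocycle φ) {a b : V} {u v : EdgePath a b} (α : Shuffle u v) :
    v.sortCost φ = α.cost φ * u.sortCost φ := by
  induction α with
  | nil w => simp [Shuffle.cost]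
  | cons τ α ih => rw [ih, τ.sortCost_eq hφ, Shuffle.cost, ← mul_assoc, mul_comm (α.cost φ)]

theorem preferred_sorted {a b : V} (f : a ⟶ b) : (preferred f).Sorted :=
  (exists_preferred f).choose_spec.1

theorem prod_preferred {a b : V} (f : a ⟶ b) : (preferred f).prod = f :=
  (exists_preferred f).choose_spec.2

theorem EdgePath.Sorted.preferred_prod {a b : V} {p : EdgePath a b} (h : p.Sorted) :
    preferred p.prod = p :=
  EdgePath.eq_of_sorted _ _ (preferred_sorted _) h (prod_preferred _)

theorem preferred_id (a : V) : preferred (𝟙 a) = EdgePath.nil :=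
  EdgePath.sorted_nil.preferred_prod

theorem EdgePath.sorted_single {a b : V} (e : Edge a b) : (EdgePath.nil.snoc e).Sorted := by
  simp [EdgePath.Sorted, EdgePath.colours]

theorem preferred_edge {a b : V} (e : Edge a b) : preferred e.hom = EdgePath.nil.snoc e :=
  EdgePath.eq_of_sorted _ _ (preferred_sorted _) (EdgePath.sorted_single e)
    ((prod_preferred _).trans (by simp [EdgePath.prod]))

/-- This is the independence of procedure: the cost of the arbitrarily chosen shuffle equals the
canonical insertion cost. -/
theorem shuffleCost_eq_sortCost {A : Type*} [CommGroup A] {φ : Cube V 2 → A}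
    (hφ : IsCubicalCocycle φ) {a b : V} (p : EdgePath a b) :
    shuffleCost φ p = p.sortCost φ := by
  have h := (exists_shuffle_preferred p).some.sortCost_eq hφ
  rw [EdgePath.sortCost_of_sorted φ (preferred_sorted _), mul_one] at h
  exact h.symm

theorem catCocycle_eq {A : Type*} [CommGroup A] {φ : Cube V 2 → A}
    (hφ : IsCubicalCocycle φ) {a b c : V} (μ : a ⟶ b) (ν : b ⟶ c) :
    catCocycle φ μ ν = ((preferred μ).comp (preferred ν)).sortCost φ :=
  shuffleCost_eq_sortCost hφ _

end Combinatorics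

/-! ### The categorical cocycle identity for `c_φ` and its values on edges. -/

section Cocycle

variable {k : ℕ} {V : Type u} [SmallCategory V] [KGraph k V]

theorem EdgePath.nil_comp {a b : V} (p : EdgePath a b) : EdgePath.nil.comp p = p := by
  induction p with
  | nil => rfl
  | snoc p e ih => simp only [EdgePath.comp, ih]

theorem EdgePath.comp_assoc {a b c d : V} (p : EdgePath a b) (q : EdgePath b c)
    (r : EdgePath c d) : (p.comp q).comp r = p.comp (q.comp r) := by
  induction r with
  | nil => rfl
  | snoc r e ih => simp only [EdgePath.comp, ih]

/-- Insertion sort treats `p` before `r`, and the edges of `r` only meet the sorted form of `p`,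
which depends on `p.prod` alone. -/
theorem EdgePath.sortCost_comp {A : Type*} [CommGroup A] (φ : Cube V 2 → A) {a b c : V}
    (p : EdgePath a b) (r : EdgePath b c) :
    (p.comp r).sortCost φ = p.sortCost φ * ((preferred p.prod).comp r).sortCost φ := by
  induction r with
  | nil =>
    simp only [EdgePath.comp, EdgePath.sortCost_of_sorted φ (preferred_sorted p.prod), mul_one]
  | snoc r e ih =>
    have h : (p.comp r).sort = ((preferred p.prod).comp r).sort :=
      EdgePath.sort_congr (by simp only [EdgePath.prod_comp, prod_preferred])
    simp only [EdgePath.comp, EdgePath.sortCost, ih, h, mul_assoc]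

theorem Transition.sortCost_comp {A : Type*} [CommGroup A] {φ : Cube V 2 → A}
    (hφ : IsCubicalCocycle φ) {a b c : V} (p : EdgePath a b) {u v : EdgePath b c}
    (τ : Transition u v) :
    (p.comp v).sortCost φ = τ.cost φ * (p.comp u).sortCost φ := by
  cases τ with
  | swap x f g g' f' y lt hf hg eq =>
    rw [← EdgePath.comp_assoc, ← EdgePath.comp_assoc]
    exact (Transition.swap (p.comp x) f g g' f' y lt hf hg eq).sortCost_eq hφ

theorem Shuffle.sortCost_comp {A : Type*} [CommGroup A] {φ : Cube V 2 → A}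
    (hφ : IsCubicalCocycle φ) {a b c : V} (p : EdgePath a b) {u v : EdgePath b c}
    (α : Shuffle u v) :
    (p.comp v).sortCost φ = α.cost φ * (p.comp u).sortCost φ := by
  induction α with
  | nil w => simp [Shuffle.cost]
  | cons τ α ih => rw [ih, τ.sortCost_comp hφ, Shuffle.cost, ← mul_assoc, mul_comm (α.cost φ)]

/-- Insertion works from the left, so sorting the right factor first needs the independence of
procedure: a shuffle of `r` is also one of `p.comp r` with the same cost. -/
theorem EdgePath.comp_sortCost {A : Type*} [CommGroup A] {φ : Cube V 2 → A}
    (hφ : IsCubicalCocycle φ) {a b c : V} (p : EdgePath a b) (r : EdgePath b c) :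
    (p.comp r).sortCost φ = r.sortCost φ * (p.comp (preferred r.prod)).sortCost φ := by
  rw [← shuffleCost_eq_sortCost hφ r]
  exact (exists_shuffle_preferred r).some.sortCost_comp hφ p

/-- The cochain `c_φ` of a cubical `2`-cocycle is a categorical `2`-cocycle. -/
theorem IsCubicalCocycle.isCatCocycle2 {A : Type*} [CommGroup A] {φ : Cube V 2 → A}
    (hφ : IsCubicalCocycle φ) : IsCatCocycle2 (catCocycle φ) := by
  refine ⟨fun v w f => ⟨?_, ?_⟩, fun x₀ x₁ x₂ x₃ f g h => ?_⟩
  · rw [catCocycle_eq hφ, preferred_id, EdgePath.nil_comp]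
    exact EdgePath.sortCost_of_sorted φ (preferred_sorted f)
  · rw [catCocycle_eq hφ, preferred_id]
    exact EdgePath.sortCost_of_sorted φ (preferred_sorted f)
  -- The cost of the word formed by the three preferred factorisations: `h1` sorts the left pair
  -- first, giving `c(f,g) c(fg,h)`; `h2` sorts the right pair first, giving `c(g,h) c(f,gh)`.
  · have h1 := EdgePath.sortCost_comp φ ((preferred f).comp (preferred g)) (preferred h)
    have h2 := EdgePath.comp_sortCost hφ (preferred f) ((preferred g).comp (preferred h))
    rw [EdgePath.comp_assoc, h2] at h1
    simp only [EdgePath.prod_comp, prod_preferred, ← catCocycle_eq hφ] at h1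
    rw [coboundary2, mul_right_comm, mul_right_comm, mul_inv_eq_one, mul_right_comm, h1]
    simp [mul_assoc]

/-- `c_φ(ν', μ') = φ(μν)` if `μν = ν'μ'` and the colour of `μ` is less than that of `ν`. -/
theorem IsCubicalCocycle.catCocycle_square {A : Type*} [CommGroup A] {φ : Cube V 2 → A}
    (hφ : IsCubicalCocycle φ) {a b b' c : V} (μ : Edge a b) (ν : Edge b c) (ν' : Edge a b')
    (μ' : Edge b' c) (h : μ.colour < ν.colour) (hμ : μ'.colour = μ.colour)
    (hν : ν'.colour = ν.colour) (eq : μ.hom ≫ ν.hom = ν'.hom ≫ μ'.hom) :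
    catCocycle φ ν'.hom μ'.hom = φ (square μ ν h.ne) := by
  rw [catCocycle_eq hφ, preferred_edge, preferred_edge]
  have key := (Transition.swap EdgePath.nil μ ν ν' μ' EdgePath.nil h hμ hν eq).sortCost_eq hφ
  have hs : ((EdgePath.nil.snoc μ).snoc ν).Sorted := (EdgePath.sorted_single μ).snoc_snoc h.le
  simp only [EdgePath.comp, EdgePath.sortCost_of_sorted φ hs, mul_one] at key
  exact key

/-- `c_φ(μ, e) = 1` if the preferred factorisation of `μ` followed by the edge `e` is the preferred
factorisation of `μe`. -/
theorem IsCubicalCocycle.catCocycle_of_sorted {A : Type*} [CommGroup A] {φ : Cube V 2 → A}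
    (hφ : IsCubicalCocycle φ) {a b c : V} {q : EdgePath a b} {e : Edge b c}
    (h : (q.snoc e).Sorted) : catCocycle φ q.prod e.hom = 1 := by
  rw [catCocycle_eq hφ, preferred_edge, (EdgePath.sorted_snoc.1 h).1.preferred_prod]
  exact EdgePath.sortCost_of_sorted φ h

end Cocycle

section CStar

/-! ### Generalities on C⋆-algebras -/

/-- Expanding `(xq - x)⋆(xq - x)` gives `0`, and the C⋆-identity finishes. -/
theorem mul_eq_self_of_star_mul {B : Type*} [NonUnitalCStarAlgebra B] {x q : B}
    (hq : IsStarProjection q) (h : star x * x = q) : x * q = x := by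
  have h1 : star (x * q - x) * (x * q - x) = 0 := by
    have h2 : q * q = q := hq.isIdempotentElem
    have h3 : star q = q := hq.isSelfAdjoint
    have h4 : star (x * q - x) * (x * q - x) =
        q * (star x * x) * q - q * (star x * x) - (star x * x) * q + star x * x := by
      simp only [star_sub, star_mul, h3]
      noncomm_ring
    rw [h4, h, h2, h2]
    simp
  exact sub_eq_zero.1 (CStarRing.star_mul_self_eq_zero_iff _ |>.1 h1)

/-- The positive elements `(p sᵢ - sᵢ)(p sᵢ - sᵢ)⋆` add up to `p - p - p + p = 0`, so each vanishes.
No orthogonality of the ranges is assumed. -/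
theorem mul_eq_self_of_sum {B : Type*} [NonUnitalCStarAlgebra B] {ι : Type*} [Fintype ι]
    {p : B} (hp : IsStarProjection p) (s : ι → B) (h : p = ∑ i, s i * star (s i)) (i : ι) :
    p * s i = s i := by
  let := CStarAlgebra.spectralOrder B
  have := CStarAlgebra.spectralOrderedRing B
  have hpp : p * p = p := hp.isIdempotentElem
  have hps : star p = p := hp.isSelfAdjoint
  have h1 : ∑ i, (p * s i - s i) * star (p * s i - s i) = 0 := by
    have h4 : ∀ i, (p * s i - s i) * star (p * s i - s i) =
        p * (s i * star (s i)) * p - p * (s i * star (s i)) - (s i * star (s i)) * p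
          + s i * star (s i) := by
      intro i
      simp only [star_sub, star_mul, hps]
      noncomm_ring
    simp only [h4, Finset.sum_add_distrib, Finset.sum_sub_distrib, ← Finset.mul_sum,
      ← Finset.sum_mul, ← h, hpp]
    simp
  have h2 := (Finset.sum_eq_zero_iff_of_nonneg (fun i _ => mul_star_self_nonneg _)).1 h1 i
    (Finset.mem_univ i)
  exact sub_eq_zero.1 (CStarRing.mul_star_self_eq_zero_iff _ |>.1 h2)

open scoped CStarAlgebra in
/-- Star homomorphisms on a closed subalgebra that agree on topological generators are equal. -/
theorem starAlgHom_ext_of_adjoin {A : Type*} {B : Type*} [NonUnitalCStarAlgebra A]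
    [NonUnitalCStarAlgebra B] {S : Set A}
    (F G : (NonUnitalStarAlgebra.adjoin ℂ S).topologicalClosure →⋆ₙₐ[ℂ] B)
    (h : ∀ x (hx : x ∈ S), F ⟨x, NonUnitalStarSubalgebra.le_topologicalClosure _
      (NonUnitalStarAlgebra.subset_adjoin ℂ S hx)⟩ = G ⟨x,
      NonUnitalStarSubalgebra.le_topologicalClosure _
      (NonUnitalStarAlgebra.subset_adjoin ℂ S hx)⟩) : F = G := by
  let T := NonUnitalStarAlgebra.adjoin ℂ S
  -- With this structure on the domain, star homomorphisms are automatically continuous, so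
  -- agreement on the dense subalgebra suffices.
  let : NonUnitalCStarAlgebra T.topologicalClosure :=
    NonUnitalStarSubalgebra.nonUnitalCStarAlgebra T.topologicalClosure
      (h_closed := NonUnitalStarSubalgebra.isClosed_topologicalClosure _)
  have hF : Continuous F := map_continuous F
  have hG : Continuous G := map_continuous G
  have hle : T ≤ T.topologicalClosure := NonUnitalStarSubalgebra.le_topologicalClosure _
  have hdense : DenseRange (Set.inclusion hle) :=
    (denseRange_inclusion_iff hle).2 (show closure (T : Set A) ⊆ closure (T : Set A) from le_rfl)
  have key : ∀ x (hx : x ∈ T), F ⟨x, hle hx⟩ = G ⟨x, hle hx⟩ := by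
    intro x hx
    induction hx using NonUnitalStarAlgebra.adjoin_induction with
    | mem x hx => exact h x hx
    | add x y hx hy h1 h2 =>
      exact (map_add F ⟨x, hle hx⟩ ⟨y, hle hy⟩).trans
        ((congrArg₂ _ h1 h2).trans (map_add G ⟨x, hle hx⟩ ⟨y, hle hy⟩).symm)
    | zero => exact (map_zero F).trans (map_zero G).symm
    | mul x y hx hy h1 h2 =>
      exact (map_mul F ⟨x, hle hx⟩ ⟨y, hle hy⟩).trans
        ((congrArg₂ _ h1 h2).trans (map_mul G ⟨x, hle hx⟩ ⟨y, hle hy⟩).symm)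
    | smul r x hx h1 =>
      exact (map_smul F r ⟨x, hle hx⟩).trans
        ((congrArg _ h1).trans (map_smul G r ⟨x, hle hx⟩).symm)
    | star x hx h1 =>
      exact (map_star F ⟨x, hle hx⟩).trans
        ((congrArg _ h1).trans (map_star G ⟨x, hle hx⟩).symm)
  have hfun : (F : T.topologicalClosure → B) = G :=
    hdense.equalizer hF hG (funext fun x => key x.1 x.2)
  exact DFunLike.coe_injective hfun

/-- Formal ⋆-polynomials without constant term. -/
inductive StarTerm (ι : Type u) : Type u
  | var (i : ι) : StarTerm ι
  | zero : StarTerm ι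
  | add (x y : StarTerm ι) : StarTerm ι
  | mul (x y : StarTerm ι) : StarTerm ι
  | smul (c : ℂ) (x : StarTerm ι) : StarTerm ι
  | star (x : StarTerm ι) : StarTerm ι

/-- Evaluation of formal ⋆-polynomials. -/
noncomputable def StarTerm.eval {ι : Type u} {B : Type w} [NonUnitalCStarAlgebra B] (g : ι → B) :
    StarTerm ι → B
  | .var i => g i
  | .zero => 0
  | .add x y => x.eval g + y.eval g
  | .mul x y => x.eval g * y.eval g
  | .smul c x => c • x.eval g
  | .star x => Star.star (x.eval g)

theorem StarTerm.exists_eval_eq {ι : Type u} {B : Type w} [NonUnitalCStarAlgebra B] (g : ι → B)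
    {x : B} (hx : x ∈ NonUnitalStarAlgebra.adjoin ℂ (Set.range g)) :
    ∃ t : StarTerm ι, t.eval g = x := by
  induction hx using NonUnitalStarAlgebra.adjoin_induction with
  | mem x hx =>
    obtain ⟨i, rfl⟩ := hx
    exact ⟨.var i, rfl⟩
  | add x y _ _ hx hy =>
    obtain ⟨s, rfl⟩ := hx
    obtain ⟨t, rfl⟩ := hy
    exact ⟨.add s t, rfl⟩
  | zero => exact ⟨.zero, rfl⟩
  | mul x y _ _ hx hy =>
    obtain ⟨s, rfl⟩ := hx
    obtain ⟨t, rfl⟩ := hy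
    exact ⟨.mul s t, rfl⟩
  | smul r x _ hx =>
    obtain ⟨s, rfl⟩ := hx
    exact ⟨.smul r s, rfl⟩
  | star x _ hx =>
    obtain ⟨s, rfl⟩ := hx
    exact ⟨.star s, rfl⟩

/-- Every point of the closure is the limit of a sequence of evaluated formal ⋆-polynomials in the
generators, and such sequences form a type in the universe of `ι`, whatever the universe of `B`. -/
theorem small_topologicalClosure_adjoin {ι : Type u} {B : Type w} [NonUnitalCStarAlgebra B]
    (g : ι → B) :
    Small.{u} (NonUnitalStarAlgebra.adjoin ℂ (Set.range g)).topologicalClosure := by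
  classical
  -- A sequence of terms is sent to its limit; the value `0` for sequences without a limit in the
  -- closure is a harmless default.
  let F : (ℕ → StarTerm ι) → (NonUnitalStarAlgebra.adjoin ℂ (Set.range g)).topologicalClosure :=
    fun a => if h : ∃ x : (NonUnitalStarAlgebra.adjoin ℂ (Set.range g)).topologicalClosure,
      Filter.Tendsto (fun n => (a n).eval g) Filter.atTop (nhds (x : B)) then h.choose else 0
  refine small_of_surjective (f := F) fun x => ?_
  obtain ⟨y, hy, hyx⟩ := mem_closure_iff_seq_limit.1
    (show (x : B) ∈ closure (NonUnitalStarAlgebra.adjoin ℂ (Set.range g) : Set B) from x.2)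
  choose a ha using fun n => StarTerm.exists_eval_eq g (hy n)
  have hex : ∃ x : (NonUnitalStarAlgebra.adjoin ℂ (Set.range g)).topologicalClosure,
      Filter.Tendsto (fun n => (a n).eval g) Filter.atTop (nhds (x : B)) :=
    ⟨x, by simpa only [ha] using hyx⟩
  refine ⟨a, ?_⟩
  simp only [F, dif_pos hex]
  exact Subtype.ext (tendsto_nhds_unique hex.choose_spec (by simpa only [ha] using hyx))

/-- A C⋆-algebra with a small underlying type is isomorphic to one in the smaller universe. -/
theorem exists_small_model (A : Type w) [NonUnitalCStarAlgebra A] [Small.{u} A] :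
    ∃ (C : Type u) (_ : NonUnitalCStarAlgebra C) (j : C →⋆ₙₐ[ℂ] A), Function.Bijective j := by
  let e := Shrink.ringEquiv.{u} A
  let : Star (Shrink.{u} A) := ⟨fun x => e.symm (star (e x))⟩
  have e_star : ∀ x, e (star x) = star (e x) := fun x => e.apply_symm_apply _
  have e_smul : ∀ (c : ℂ) x, e (c • x) = c • e x := fun c x => equivShrink_symm_smul c x
  let : StarRing (Shrink.{u} A) :=
    { star_involutive := fun x => e.injective (by rw [e_star, e_star, star_star])
      star_mul := fun x y => e.injective (by simp only [e_star, map_mul, star_mul])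
      star_add := fun x y => e.injective (by simp only [e_star, map_add, star_add]) }
  -- The norm is pulled back along `e`, so that `e` is isometric by definition and completeness
  -- transfers.
  let : NonUnitalNormedRing (Shrink.{u} A) := NonUnitalNormedRing.induced _ A e e.injective
  have e_norm : ∀ x, ‖e x‖ = ‖x‖ := fun x => rfl
  have e_isom : Isometry e := AddMonoidHomClass.isometry_of_norm e e_norm
  have e_complete : CompleteSpace (Shrink.{u} A) :=
    (completeSpace_congr (e := e.toEquiv) e_isom.isUniformEmbedding).2 inferInstance
  let _ : NonUnitalCStarAlgebra (Shrink.{u} A) :=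
    { norm_smul_le := fun c x =>
        (congrArg norm (e_smul c x)).trans_le (norm_smul_le c (e x))
      complete := e_complete.complete
      norm_mul_self_le := fun x => by
        rw [← e_norm, ← e_norm, map_mul, e_star, CStarRing.norm_star_mul_self]
      smul_assoc := fun c x y => e.injective (by
        simp only [smul_eq_mul, map_mul, e_smul, smul_mul_assoc])
      smul_comm := fun c x y => e.injective (by
        simp only [smul_eq_mul, map_mul, e_smul, mul_smul_comm])
      star_smul := fun c x => e.injective (by simp only [e_smul, e_star, star_smul]) }
  exact ⟨Shrink.{u} A, inferInstance,
    { toFun := e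
      map_smul' := e_smul
      map_zero' := map_zero e
      map_add' := map_add e
      map_mul' := map_mul e
      map_star' := e_star }, e.bijective⟩

/-- Families in a C⋆-algebra come from families in a C⋆-algebra of the universe of the index
type. -/
theorem exists_small_hull {ι : Type u} {B : Type w} [NonUnitalCStarAlgebra B] (g : ι → B) :
    ∃ (C : Type u) (_ : NonUnitalCStarAlgebra C) (j : C →⋆ₙₐ[ℂ] B),
      Function.Injective j ∧ ∃ g' : ι → C, ∀ i, j (g' i) = g i := by
  let T := NonUnitalStarAlgebra.adjoin ℂ (Set.range g)
  let : NonUnitalCStarAlgebra T.topologicalClosure :=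
    NonUnitalStarSubalgebra.nonUnitalCStarAlgebra T.topologicalClosure
      (h_closed := NonUnitalStarSubalgebra.isClosed_topologicalClosure _)
  have : Small.{u} T.topologicalClosure := small_topologicalClosure_adjoin g
  obtain ⟨C, hC, j, hj⟩ := exists_small_model.{u} T.topologicalClosure
  have hg : ∀ i, ∃ y, j y = ⟨g i, NonUnitalStarSubalgebra.le_topologicalClosure _
      (NonUnitalStarAlgebra.subset_adjoin ℂ _ ⟨i, rfl⟩)⟩ := fun i => hj.2 _
  choose g' hg' using hg
  let i₀ : T.topologicalClosure →⋆ₙₐ[ℂ] B :=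
    { toFun := Subtype.val
      map_smul' := fun _ _ => rfl
      map_zero' := rfl
      map_add' := fun _ _ => rfl
      map_mul' := fun _ _ => rfl
      map_star' := fun _ => rfl }
  exact ⟨C, hC, i₀.comp j, Subtype.val_injective.comp hj.1, g', fun i =>
    congrArg Subtype.val (hg' i)⟩

/-- The coordinates of the `ℓ^∞`-product, as star homomorphisms. -/
def lpEval {I : Type*} (C : I → Type*) [∀ i, NonUnitalCStarAlgebra (C i)] (i : I) :
    lp C ∞ →⋆ₙₐ[ℂ] C i where
  toFun x := x i
  map_smul' _ _ := rfl
  map_zero' := rfl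
  map_add' _ _ := rfl
  map_mul' _ _ := rfl
  map_star' _ := rfl

end CStar

/-! ### Passage between representations and families, and the universal properties. -/

section Representations

variable {k : ℕ} {V : Type u} [SmallCategory V] [KGraph k V]

/-! ### Edges and elements of given degree -/

/-- Edges of colour `i` are the elements of degree `e_i`. -/
def edgeEquiv (v : V) (i : Fin k) : {e : Σ w : V, Edge v w // e.2.colour = i} ≃
    {x : Σ w : V, (v ⟶ w) // degree x.2 = Pi.single i 1} where
  toFun e := ⟨⟨e.1.1, e.1.2.hom⟩, by rw [e.1.2.degree_hom, e.2]⟩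
  invFun x := ⟨⟨x.1.1, ⟨i, x.1.2, x.2⟩⟩, rfl⟩
  left_inv := by
    rintro ⟨⟨w, e⟩, rfl⟩
    rfl
  right_inv _ := rfl

theorem RowFinite.finite_edges (hrow : RowFinite V) (v : V) (i : Fin k) :
    Finite {e : Σ w : V, Edge v w // e.2.colour = i} :=
  have := hrow v (Pi.single i 1)
  Finite.of_equiv _ (edgeEquiv v i).symm

theorem NoSources.nonempty_edges (hsrc : NoSources V) (v : V) (i : Fin k) :
    Nonempty {e : Σ w : V, Edge v w // e.2.colour = i} :=
  (hsrc v (Pi.single i 1)).map (edgeEquiv v i).symm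

/-- The elements of degree `m + n` are the products of elements of degrees `m` and `n`. -/
theorem bijective_comp_of_degree (v : V) (m n : Fin k → ℕ) :
    Function.Bijective (fun z : Σ x : {x : Σ w : V, (v ⟶ w) // degree x.2 = m},
        {y : Σ w : V, (x.1.1 ⟶ w) // degree y.2 = n} =>
      (⟨⟨z.2.1.1, z.1.1.2 ≫ z.2.1.2⟩, by rw [degree_comp, z.1.2, z.2.2]⟩ :
        {x : Σ w : V, (v ⟶ w) // degree x.2 = m + n})) := by
  constructor
  · rintro ⟨⟨⟨a, f⟩, hf⟩, ⟨⟨b, g⟩, hg⟩⟩ ⟨⟨⟨a', f'⟩, hf'⟩, ⟨⟨b', g'⟩, hg'⟩⟩ h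
    obtain ⟨rfl, h1⟩ := Sigma.mk.inj_iff.1 (congrArg Subtype.val h)
    obtain ⟨rfl, h2⟩ := Sigma.mk.inj_iff.1 (factor_unique (eq_of_heq h1) (hf.trans hf'.symm))
    obtain ⟨rfl, rfl⟩ := Prod.mk.inj (eq_of_heq h2)
    rfl
  · rintro ⟨⟨b, f⟩, hf⟩
    obtain ⟨h1, h2, h3⟩ := factor_spec f m n hf
    exact ⟨⟨⟨⟨_, _⟩, h1⟩, ⟨⟨_, _⟩, h2⟩⟩, Subtype.ext (congrArg (Sigma.mk b) h3)⟩

section Algebra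

variable {B : Type*} [NonUnitalCStarAlgebra B]

theorem circle_smul_mul_star (z : Circle) (x : B) :
    ((z : ℂ) • x) * star ((z : ℂ) • x) = x * star x := by
  rw [star_smul, smul_mul_smul_comm, Complex.star_def, Complex.mul_conj, Circle.normSq_coe]
  simp

theorem circle_star_smul_mul (z : Circle) (x : B) :
    star ((z : ℂ) • x) * ((z : ℂ) • x) = star x * x := by
  rw [star_smul, smul_mul_smul_comm, Complex.star_def, mul_comm, Complex.mul_conj,
    Circle.normSq_coe]
  simp

/-! ### The family of a representation -/

variable {φ : Cube V 2 → Circle} {p : V → B} {s : ∀ ⦃v w : V⦄, Edge v w → B}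

theorem IsCKRep.edge_mul (h : IsCKRep φ p s) {v w : V} (e : Edge v w) : s e * p w = s e :=
  mul_eq_self_of_star_mul (h.proj w) (h.star_mul e)

/-- Relation (iii) at `v` for the colour of `e` has `s e * star (s e)` among its terms, so `p v`
absorbs `s e` by positivity. -/
theorem IsCKRep.mul_edge (h : IsCKRep φ p s) (hrow : RowFinite V) {v w : V} (e : Edge v w) :
    p v * s e = s e := by
  have := hrow.finite_edges v e.colour
  let _ := Fintype.ofFinite {x : Σ w : V, Edge v w // x.2.colour = e.colour}
  have h1 := h.sum_eq v e.colour ⟨⟨⟨w, e⟩, rfl⟩⟩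
  rw [finsum_eq_sum_of_fintype] at h1
  exact mul_eq_self_of_sum (h.proj v)
    (fun x : {x : Σ w : V, Edge v w // x.2.colour = e.colour} => s x.1.2) h1 ⟨⟨w, e⟩, rfl⟩

/-- By definition a path of length one gives `s e` without the factor `p a`. Absorption makes the
recursion uniform from length zero on. -/
theorem IsCKRep.pathProduct_snoc (h : IsCKRep φ p s) (hrow : RowFinite V) {a b c : V}
    (q : EdgePath a b) (e : Edge b c) :
    pathProduct p s (q.snoc e) = pathProduct p s q * s e := by
  cases q with
  | nil => exact (h.mul_edge hrow e).symm
  | snoc q f => rfl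

theorem IsCKRep.pathProduct_mul (h : IsCKRep φ p s) (hrow : RowFinite V) {a b : V}
    (q : EdgePath a b) : pathProduct p s q * p b = pathProduct p s q := by
  cases q with
  | nil => exact (h.proj a).isIdempotentElem
  | snoc q e => rw [h.pathProduct_snoc hrow, mul_assoc, h.edge_mul]

theorem IsCKRep.pathProduct_comp (h : IsCKRep φ p s) (hrow : RowFinite V) {a b c : V}
    (q : EdgePath a b) (r : EdgePath b c) :
    pathProduct p s (q.comp r) = pathProduct p s q * pathProduct p s r := by
  induction r with
  | nil => exact (h.pathProduct_mul hrow q).symm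
  | snoc r e ih => rw [EdgePath.comp, h.pathProduct_snoc hrow, h.pathProduct_snoc hrow, ih,
      mul_assoc]

/-- Relation (ii) applied to the two swapped edges; the scalar then moves out of the product. -/
theorem IsCKRep.pathProduct_transition (h : IsCKRep φ p s) (hrow : RowFinite V) {a b : V}
    {q r : EdgePath a b} (τ : Transition q r) :
    pathProduct p s r = ((τ.cost φ : Circle) : ℂ) • pathProduct p s q := by
  cases τ with
  | swap x f g g' f' y lt hf hg eq =>
    rw [h.pathProduct_comp hrow, h.pathProduct_comp hrow, h.pathProduct_snoc hrow,
      h.pathProduct_snoc hrow, h.pathProduct_snoc hrow, h.pathProduct_snoc hrow, mul_assoc _ (s g'),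
      mul_assoc _ (s f), h.twist f g g' f' lt hf hg eq, mul_smul_comm, smul_mul_assoc]
    rfl

theorem IsCKRep.pathProduct_shuffle (h : IsCKRep φ p s) (hrow : RowFinite V) {a b : V}
    {q r : EdgePath a b} (α : Shuffle q r) :
    pathProduct p s r = ((α.cost φ : Circle) : ℂ) • pathProduct p s q := by
  induction α with
  | nil w => simp [Shuffle.cost]
  | cons τ α ih =>
    rw [ih, h.pathProduct_transition hrow τ, Shuffle.cost, smul_smul, mul_comm, Circle.coe_mul]

theorem IsCKRep.star_pathProduct_mul (h : IsCKRep φ p s) (hrow : RowFinite V) {a b : V}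
    (q : EdgePath a b) : star (pathProduct p s q) * pathProduct p s q = p b := by
  induction q with
  | nil =>
    change star (p a) * p a = p a
    rw [(h.proj a).isSelfAdjoint.star_eq, (h.proj a).isIdempotentElem]
  | snoc q e ih =>
    rw [h.pathProduct_snoc hrow, StarMul.star_mul, mul_assoc, ← mul_assoc (star (pathProduct p s q)),
      ih,
      h.mul_edge hrow, h.star_mul]

/-- The summation relations in all degrees follow from those for the generators of `ℕ^k`. -/
theorem sum_eq_of_single (hrow : RowFinite V) {c : Fun2 V Circle} {t : Fun1 V B}
    (proj : ∀ v, IsStarProjection (t (𝟙 v)))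
    (mul_id : ∀ ⦃v w : V⦄ (f : v ⟶ w), t f * t (𝟙 w) = t f)
    (mul_eq : ∀ ⦃a b d : V⦄ (μ : a ⟶ b) (ν : b ⟶ d), t μ * t ν = (c μ ν : ℂ) • t (μ ≫ ν))
    (sum_eq : ∀ (v : V) (i : Fin k), t (𝟙 v) =
      ∑ᶠ x : {x : Σ w : V, (v ⟶ w) // degree x.2 = Pi.single i 1}, t x.1.2 * star (t x.1.2))
    (N : ℕ) : ∀ (v : V) (n : Fin k → ℕ), ∑ i, n i = N → t (𝟙 v) =
      ∑ᶠ x : {x : Σ w : V, (v ⟶ w) // degree x.2 = n}, t x.1.2 * star (t x.1.2) := by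
  induction N with
  | zero =>
    intro v n hn
    obtain rfl : n = 0 := by
      funext i
      exact (Finset.sum_eq_zero_iff.1 hn) i (Finset.mem_univ i)
    have huniq : ∀ x : {x : Σ w : V, (v ⟶ w) // degree x.2 = 0}, x = ⟨⟨v, 𝟙 v⟩, degree_id v⟩ :=
      fun x => Subtype.ext (eq_id_of_degree_eq_zero x.1.2 x.2)
    let _ : Unique {x : Σ w : V, (v ⟶ w) // degree x.2 = 0} := ⟨⟨⟨⟨v, 𝟙 v⟩, degree_id v⟩⟩, huniq⟩
    rw [finsum_unique]
    change t (𝟙 v) = t (𝟙 v) * star (t (𝟙 v))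
    rw [(proj v).isSelfAdjoint.star_eq, (proj v).isIdempotentElem]
  | succ N ih =>
    intro v n hn
    obtain ⟨i, hi⟩ : ∃ i, n i ≠ 0 := by
      by_contra hcon
      push Not at hcon
      simp [hcon] at hn
    obtain ⟨m, rfl⟩ : ∃ m : Fin k → ℕ, n = m + Pi.single i 1 := by
      refine ⟨n - Pi.single i 1, ?_⟩
      funext j
      by_cases hj : j = i
      · subst hj
        simp only [Pi.add_apply, Pi.sub_apply, Pi.single_eq_same]
        omega
      · simp [hj]
    have hm : ∑ j, m j = N := by simpa [Finset.sum_add_distrib] using hn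
    have hfin : ∀ (v : V) (n : Fin k → ℕ), Finite {x : Σ w : V, (v ⟶ w) // degree x.2 = n} := hrow
    let _ : ∀ (v : V) (n : Fin k → ℕ), Fintype {x : Σ w : V, (v ⟶ w) // degree x.2 = n} :=
      fun v n => Fintype.ofFinite _
    -- By unique factorisation, the sum over degree `m + e_i` becomes a double sum over an element
    -- `x` of degree `m` and a continuation `y` of degree `e_i`.
    rw [ih v m hm, finsum_eq_sum_of_fintype, finsum_eq_sum_of_fintype,
      ← (bijective_comp_of_degree v m (Pi.single i 1)).sum_comp, Fintype.sum_sigma]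
    refine Finset.sum_congr rfl fun x _ => ?_
    have h1 : ∀ y : {y : Σ w : V, (x.1.1 ⟶ w) // degree y.2 = Pi.single i 1},
        t (x.1.2 ≫ y.1.2) * star (t (x.1.2 ≫ y.1.2)) =
          t x.1.2 * (t y.1.2 * star (t y.1.2)) * star (t x.1.2) := by
      intro y
      -- The value of `c` has modulus one, so it can be inserted into `t t⋆` at no cost in order to
      -- split `t (xy)`.
      rw [← circle_smul_mul_star (c x.1.2 y.1.2), ← mul_eq, star_mul]
      simp only [mul_assoc]
    simp only [h1]
    -- The inner sum over `y` is the vertex projection at the source of `x`, which `t x` absorbs.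
    rw [← Finset.sum_mul, ← Finset.mul_sum, ← finsum_eq_sum_of_fintype, ← sum_eq, mul_id]

/-- Products of a representation along preferred factorisations form a family. -/
theorem IsCKRep.isCKFamily (h : IsCKRep φ p s) (hrow : RowFinite V) (hsrc : NoSources V) :
    IsCKFamily (catCocycle φ) (fun _ _ f => pathProduct p s (preferred f) : Fun1 V B) := by
  have hid : ∀ v : V, pathProduct p s (preferred (𝟙 v)) = p v := fun v => by
    rw [preferred_id]
    rfl
  have hmul : ∀ ⦃a b d : V⦄ (μ : a ⟶ b) (ν : b ⟶ d),
      pathProduct p s (preferred μ) * pathProduct p s (preferred ν) =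
        ((catCocycle φ μ ν : Circle) : ℂ) • pathProduct p s (preferred (μ ≫ ν)) := by
    intro a b d μ ν
    -- The shuffle used here is the very one chosen in `shuffleCost`, so its cost is `catCocycle φ μ
    -- ν` by definition.
    rw [← h.pathProduct_comp hrow,
      h.pathProduct_shuffle hrow (exists_shuffle_preferred ((preferred μ).comp (preferred ν))).some]
    simp only [EdgePath.prod_comp, prod_preferred]
    rfl
  have hmulid : ∀ ⦃v w : V⦄ (f : v ⟶ w),
      pathProduct p s (preferred f) * pathProduct p s (preferred (𝟙 w)) =
        pathProduct p s (preferred f) := fun v w f => by rw [hid, h.pathProduct_mul hrow]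
  refine ⟨fun v => by rw [hid]; exact h.proj v, fun v w hvw => ?_, hmul, fun v w f => ?_,
    fun v n => ?_⟩
  · rw [hid, hid]
    exact h.orthogonal v w hvw
  · rw [hid]
    exact h.star_pathProduct_mul hrow _
  · refine sum_eq_of_single hrow (t := fun _ _ f => pathProduct p s (preferred f))
      (fun v => by rw [hid]; exact h.proj v) hmulid hmul (fun v i => ?_) _ v n rfl
    rw [hid, h.sum_eq v i (hsrc.nonempty_edges v i)]
    refine finsum_eq_of_bijective _ (edgeEquiv v i).bijective fun e => ?_
    change _ = pathProduct p s (preferred e.1.2.hom) * star (pathProduct p s (preferred e.1.2.hom))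
    rw [preferred_edge]
    rfl

/-! ### The representation of a family -/

/-- Every family restricts to a representation on the vertices and edges. -/
theorem IsCKFamily.isCKRep (hφ : IsCubicalCocycle φ) {t : Fun1 V B}
    (h : IsCKFamily (catCocycle φ) t) :
    IsCKRep φ (fun v => t (𝟙 v)) (fun _ _ e => t e.hom) where
  proj := h.proj
  orthogonal := h.orthogonal
  star_mul _ _ e := h.star_mul e.hom
  twist a b b' c μ ν ν' μ' hlt hμ hν eq := by
    -- The pair `μ ν` is already sorted and costs nothing, so the whole twist comes from `ν' μ'`.
    have h1 : catCocycle φ μ.hom ν.hom = 1 := by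
      have := hφ.catCocycle_of_sorted ((EdgePath.sorted_single μ).snoc_snoc hlt.le)
      simpa [EdgePath.prod] using this
    rw [h.mul_eq, h.mul_eq, h1, hφ.catCocycle_square μ ν ν' μ' hlt hμ hν eq, eq]
    simp
  sum_eq v i _ := by
    rw [h.sum_eq v (Pi.single i 1)]
    exact (finsum_eq_of_bijective _ (edgeEquiv v i).bijective fun e => rfl).symm

/-- A family is determined by its restriction to the vertices and edges. -/
theorem IsCKFamily.eq_pathProduct (hφ : IsCubicalCocycle φ) (hrow : RowFinite V) {t : Fun1 V B}
    (h : IsCKFamily (catCocycle φ) t) {v w : V} (f : v ⟶ w) :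
    pathProduct (fun v => t (𝟙 v)) (fun _ _ e => t e.hom) (preferred f) = t f := by
  -- The induction stays within sorted paths: there each appended edge contributes the cocycle value
  -- `1`.
  have key : ∀ {a b : V} (q : EdgePath a b), q.Sorted →
      pathProduct (fun v => t (𝟙 v)) (fun _ _ e => t e.hom) q = t q.prod := by
    intro a b q
    induction q with
    | nil => exact fun _ => rfl
    | snoc q e ih =>
      intro hq
      rw [(h.isCKRep hφ).pathProduct_snoc hrow, ih (EdgePath.sorted_snoc.1 hq).1, h.mul_eq,
        hφ.catCocycle_of_sorted hq]
      simp [EdgePath.prod]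
  rw [key _ (preferred_sorted f), prod_preferred]

/-- Multiplication of a family by a `1`-cochain. -/
theorem IsCKFamily.smul {c c' : Fun2 V Circle} {t : Fun1 V B} (h : IsCKFamily c t)
    {b : Fun1 V Circle} (hb : IsCochain1 b)
    (hc : ∀ ⦃x y z : V⦄ (μ : x ⟶ y) (ν : y ⟶ z), c' μ ν = coboundary1 b μ ν * c μ ν) :
    IsCKFamily c' (fun _ _ f => (b f : ℂ) • t f : Fun1 V B) := by
  have hid : ∀ v : V, ((b (𝟙 v) : Circle) : ℂ) • t (𝟙 v) = t (𝟙 v) := fun v => by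
    rw [hb v]
    simp
  have hcancel : ∀ x y z d : Circle, y * z⁻¹ * x * d * z = x * y * d := fun x y z d => by
    rw [mul_right_comm _ d z, mul_right_comm _ x z, inv_mul_cancel_right, mul_comm y x]
  refine ⟨fun v => by rw [hid]; exact h.proj v, fun v w hvw => ?_, fun x y z μ ν => ?_,
    fun v w f => ?_, fun v n => ?_⟩
  · rw [hid, hid]
    exact h.orthogonal v w hvw
  · rw [smul_mul_smul_comm, h.mul_eq, smul_smul, smul_smul, ← Circle.coe_mul, ← Circle.coe_mul,
      ← Circle.coe_mul, hc, coboundary1, hcancel]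
  · rw [circle_star_smul_mul, hid]
    exact h.star_mul f
  · simp only [circle_smul_mul_star, hid]
    exact h.sum_eq v n

/-! ### Transfer along jointly injective homomorphisms -/

variable {I : Type*} {C : I → Type*} [∀ i, NonUnitalCStarAlgebra (C i)]

theorem isStarProjection_of_jointly_injective (j : ∀ i, B →⋆ₙₐ[ℂ] C i)
    (hj : ∀ x y, (∀ i, j i x = j i y) → x = y) {q : B} (h : ∀ i, IsStarProjection (j i q)) :
    IsStarProjection q where
  isIdempotentElem := hj _ _ fun i => by rw [map_mul]; exact (h i).isIdempotentElem
  isSelfAdjoint := hj _ _ fun i => by rw [map_star]; exact (h i).isSelfAdjoint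

/-- The relations are equations between ⋆-polynomials, so they may be tested after a separating
collection of homomorphisms. This serves both the coordinates of the `ℓ^∞`-product and a single
injective homomorphism. -/
theorem IsCKRep.of_jointly_injective (hrow : RowFinite V) (j : ∀ i, B →⋆ₙₐ[ℂ] C i)
    (hj : ∀ x y, (∀ i, j i x = j i y) → x = y)
    (h : ∀ i, IsCKRep φ (fun v => j i (p v)) (fun _ _ e => j i (s e))) : IsCKRep φ p s where
  proj v := isStarProjection_of_jointly_injective j hj fun i => (h i).proj v
  orthogonal v w hvw := hj _ _ fun i => by
    rw [map_mul, map_zero]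
    exact (h i).orthogonal v w hvw
  star_mul v w e := hj _ _ fun i => by
    rw [map_mul, map_star]
    exact (h i).star_mul e
  twist a b b' c μ ν ν' μ' hlt hμ hν eq := hj _ _ fun i => by
    rw [map_mul, map_smul, map_mul]
    exact (h i).twist μ ν ν' μ' hlt hμ hν eq
  sum_eq v i hne := hj _ _ fun l => by
    -- Finiteness turns `∑ᶠ` into an honest finite sum, which homomorphisms preserve; with infinite
    -- support it would have the default value `0`.
    have := hrow.finite_edges v i
    let _ := Fintype.ofFinite {e : Σ w : V, Edge v w // e.2.colour = i}
    have h1 := (h l).sum_eq v i hne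
    rw [finsum_eq_sum_of_fintype] at h1 ⊢
    simpa only [map_sum, map_mul, map_star] using h1

theorem IsCKFamily.of_jointly_injective (hrow : RowFinite V) {c : Fun2 V Circle} {t : Fun1 V B}
    (j : ∀ i, B →⋆ₙₐ[ℂ] C i) (hj : ∀ x y, (∀ i, j i x = j i y) → x = y)
    (h : ∀ i, IsCKFamily c (fun _ _ f => j i (t f) : Fun1 V (C i))) : IsCKFamily c t where
  proj v := isStarProjection_of_jointly_injective j hj fun i => (h i).proj v
  orthogonal v w hvw := hj _ _ fun i => by
    rw [map_mul, map_zero]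
    exact (h i).orthogonal v w hvw
  mul_eq a b d μ ν := hj _ _ fun i => by
    rw [map_mul, map_smul]
    exact (h i).mul_eq μ ν
  star_mul v w f := hj _ _ fun i => by
    rw [map_mul, map_star]
    exact (h i).star_mul f
  sum_eq v n := hj _ _ fun l => by
    have := hrow v n
    let _ := Fintype.ofFinite {x : Σ w : V, (v ⟶ w) // degree x.2 = n}
    have h1 := (h l).sum_eq v n
    rw [finsum_eq_sum_of_fintype] at h1 ⊢
    simpa only [map_sum, map_mul, map_star] using h1

theorem map_pathProduct {D : Type*} [NonUnitalCStarAlgebra D] (π : B →⋆ₙₐ[ℂ] D) {a b : V}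
    (q : EdgePath a b) :
    π (pathProduct p s q) = pathProduct (fun v => π (p v)) (fun _ _ e => π (s e)) q := by
  induction q with
  | nil => rfl
  | snoc q e ih =>
    cases q with
    | nil => rfl
    | snoc q f => exact (map_mul π _ _).trans (congrArg (· * π (s e)) ih)

end Algebra

/-! ### Universal properties -/

/-- The coordinates of `C⋆_φ(Λ)`. -/
noncomputable def cubicalEval (φ : Cube V 2 → Circle) (ρ : CKRep φ) :
    CubicalAlgebra φ →⋆ₙₐ[ℂ] ρ.B :=
  (lpEval (fun ρ : CKRep φ => ρ.B) ρ).comp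
    (NonUnitalStarSubalgebraClass.subtype (cubicalSubalgebra φ))

/-- The coordinates of `C⋆(Λ, c)`. -/
noncomputable def catEval (c : Fun2 V Circle) (ρ : CKFamily c) : CatAlgebra c →⋆ₙₐ[ℂ] ρ.B :=
  (lpEval (fun ρ : CKFamily c => ρ.B) ρ).comp
    (NonUnitalStarSubalgebraClass.subtype (catSubalgebra c))

theorem isCKRep_univ (hrow : RowFinite V) (φ : Cube V 2 → Circle) :
    IsCKRep φ (univVertex φ) (univEdge φ) :=
  IsCKRep.of_jointly_injective hrow (cubicalEval φ)
    (fun _ _ h => Subtype.ext (lp.ext (funext h))) fun ρ => ρ.isRep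

theorem isCKFamily_univ (hrow : RowFinite V) (c : Fun2 V Circle) :
    IsCKFamily c (univElement c) :=
  IsCKFamily.of_jointly_injective hrow (catEval c)
    (fun _ _ h => Subtype.ext (lp.ext (funext h))) fun ρ => ρ.isFamily

theorem cubicalHom_ext {φ : Cube V 2 → Circle} {B : Type w} [NonUnitalCStarAlgebra B]
    {F G : CubicalAlgebra φ →⋆ₙₐ[ℂ] B} (h1 : ∀ v : V, F (univVertex φ v) = G (univVertex φ v))
    (h2 : ∀ ⦃v w : V⦄ (e : Edge v w), F (univEdge φ e) = G (univEdge φ e)) : F = G := by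
  refine starAlgHom_ext_of_adjoin F G fun x hx => ?_
  rcases hx with ⟨v, rfl⟩ | ⟨v, w, e, rfl⟩
  · exact h1 v
  · exact h2 e

theorem catHom_ext {c : Fun2 V Circle} {B : Type w} [NonUnitalCStarAlgebra B]
    {F G : CatAlgebra c →⋆ₙₐ[ℂ] B}
    (h : ∀ ⦃v w : V⦄ (f : v ⟶ w), F (univElement c f) = G (univElement c f)) : F = G := by
  refine starAlgHom_ext_of_adjoin F G fun x hx => ?_
  obtain ⟨v, w, f, rfl⟩ := hx
  exact h f

/-- The representation is lifted to a C⋆-algebra in the universe of the graph. There it is one of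
the indices `ρ` of the product, and the homomorphism is the coordinate at `ρ` followed by the
embedding into `B`. -/
theorem exists_cubicalHom (hrow : RowFinite V) {φ : Cube V 2 → Circle} {B : Type w}
    [NonUnitalCStarAlgebra B] {p : V → B} {s : ∀ ⦃v w : V⦄, Edge v w → B}
    (h : IsCKRep φ p s) :
    ∃ π : CubicalAlgebra φ →⋆ₙₐ[ℂ] B, (∀ v : V, π (univVertex φ v) = p v) ∧
      ∀ ⦃v w : V⦄ (e : Edge v w), π (univEdge φ e) = s e := by
  obtain ⟨C, hC, j, hj, g, hg⟩ := exists_small_hull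
    (Sum.elim p (fun x : Σ v w : V, Edge v w => s x.2.2))
  have hp : ∀ v, j (g (Sum.inl v)) = p v := fun v => hg _
  have hs : ∀ ⦃v w : V⦄ (e : Edge v w), j (g (Sum.inr ⟨v, w, e⟩)) = s e := fun v w e => hg _
  have hrep : IsCKRep φ (fun v => g (Sum.inl v)) (fun v w e => g (Sum.inr ⟨v, w, e⟩)) := by
    refine IsCKRep.of_jointly_injective hrow (fun _ : Unit => j) (fun x y hxy => hj (hxy ())) ?_
    intro _
    simpa only [hp, hs] using h
  let ρ : CKRep φ := { B := C, p := _, s := _, isRep := hrep }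
  exact ⟨j.comp (cubicalEval φ ρ), hp, hs⟩

theorem exists_catHom (hrow : RowFinite V) {c : Fun2 V Circle} {B : Type w}
    [NonUnitalCStarAlgebra B] {t : Fun1 V B} (h : IsCKFamily c t) :
    ∃ π : CatAlgebra c →⋆ₙₐ[ℂ] B,
      ∀ ⦃v w : V⦄ (f : v ⟶ w), π (univElement c f) = t f := by
  obtain ⟨C, hC, j, hj, g, hg⟩ := exists_small_hull (fun x : Σ v w : V, v ⟶ w => t x.2.2)
  have ht : ∀ ⦃v w : V⦄ (f : v ⟶ w), j (g ⟨v, w, f⟩) = t f := fun v w f => hg _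
  have hfam : IsCKFamily c (fun v w f => g ⟨v, w, f⟩ : Fun1 V C) := by
    refine IsCKFamily.of_jointly_injective hrow (fun _ : Unit => j) (fun x y hxy => hj (hxy ())) ?_
    intro _
    simpa only [ht] using h
  let ρ : CKFamily c := { B := C, t := _, isFamily := hfam }
  exact ⟨j.comp (catEval c ρ), ht⟩

theorem univPath_id (φ : Cube V 2 → Circle) (v : V) : univPath φ (𝟙 v) = univVertex φ v := by
  rw [univPath, preferred_id]
  rfl

theorem univPath_edge (φ : Cube V 2 → Circle) {v w : V} (e : Edge v w) :
    univPath φ e.hom = univEdge φ e := by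
  rw [univPath, preferred_edge]
  rfl

/-- Existence: restrict the family to a representation, apply the universal property, and recover
the family from its values on edges. Uniqueness: the vertex and edge elements of `univPath φ` are
the generators themselves. -/
theorem existsUnique_cubicalHom (hrow : RowFinite V) {φ : Cube V 2 → Circle}
    (hφ : IsCubicalCocycle φ) {B : Type w} [NonUnitalCStarAlgebra B] {t : Fun1 V B}
    (h : IsCKFamily (catCocycle φ) t) :
    ∃! π : CubicalAlgebra φ →⋆ₙₐ[ℂ] B, ∀ ⦃v w : V⦄ (f : v ⟶ w), π (univPath φ f) = t f := by
  obtain ⟨π, hp, hs⟩ := exists_cubicalHom hrow (h.isCKRep hφ)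
  have hπ : ∀ ⦃v w : V⦄ (f : v ⟶ w), π (univPath φ f) = t f := by
    intro v w f
    rw [univPath, map_pathProduct]
    simp only [hp, hs]
    exact h.eq_pathProduct hφ hrow f
  refine ⟨π, hπ, fun ψ hψ => cubicalHom_ext (fun v => ?_) fun v w e => ?_⟩
  · rw [← univPath_id, hψ, hπ]
  · rw [← univPath_edge, hψ, hπ]

/-- Universal families of cohomologous cocycles generate isomorphic C⋆-algebras. -/
theorem exists_equiv_of_cohomologous (hrow : RowFinite V) (hsrc : NoSources V)
    {φ : Cube V 2 → Circle} (hφ : IsCubicalCocycle φ) {c : Fun2 V Circle} {b : Fun1 V Circle}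
    (hb : IsCochain1 b)
    (hc : ∀ ⦃x y z : V⦄ (μ : x ⟶ y) (ν : y ⟶ z),
      c μ ν = coboundary1 b μ ν * catCocycle φ μ ν) :
    ∃ e : CatAlgebra c ≃⋆ₐ[ℂ] CubicalAlgebra φ,
      ∀ ⦃v w : V⦄ (f : v ⟶ w), e (univElement c f) = (b f : ℂ) • univPath φ f := by
  have hfam : IsCKFamily (catCocycle φ) (univPath φ) :=
    (isCKRep_univ hrow φ).isCKFamily hrow hsrc
  -- `F` comes from the rescaled family `b t`, and `G` below from the universal `(Λ, c)`-family
  -- rescaled by `b⁻¹`; on generators the scalars cancel, so `F` and `G` are mutually inverse.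
  obtain ⟨F, hF⟩ := exists_catHom hrow (hfam.smul hb hc)
  have hb' : IsCochain1 (fun _ _ f => (b f)⁻¹ : Fun1 V Circle) := fun v => by simp [hb v]
  have hc' : ∀ ⦃x y z : V⦄ (μ : x ⟶ y) (ν : y ⟶ z), catCocycle φ μ ν =
      coboundary1 (fun _ _ f => (b f)⁻¹ : Fun1 V Circle) μ ν * c μ ν := by
    intro x y z μ ν
    rw [hc, ← mul_assoc, eq_comm]
    refine mul_eq_right.2 ?_
    have hcancel : ∀ x y z : Circle, x⁻¹ * z⁻¹⁻¹ * y⁻¹ * (x * z⁻¹ * y) = 1 := fun x y z => by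
      rw [← mul_inv, ← mul_inv, inv_mul_cancel]
    exact hcancel _ _ _
  obtain ⟨G, hG, -⟩ := existsUnique_cubicalHom hrow hφ ((isCKFamily_univ hrow c).smul hb' hc')
  have hbb : ∀ ⦃v w : V⦄ (f : v ⟶ w), ((b f : Circle) : ℂ) * (((b f)⁻¹ : Circle) : ℂ) = 1 := by
    intro v w f
    rw [← Circle.coe_mul, mul_inv_cancel, Circle.coe_one]
  have hGF : G.comp F = NonUnitalStarAlgHom.id ℂ (CatAlgebra c) := catHom_ext fun v w f => by
    change G (F _) = univElement c f
    rw [hF, map_smul, hG, smul_smul, hbb, one_smul]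
  have hFG' : ∀ ⦃v w : V⦄ (f : v ⟶ w), F (G (univPath φ f)) = univPath φ f := by
    intro v w f
    rw [hG, map_smul, hF, smul_smul, mul_comm, hbb, one_smul]
  have hFG : F.comp G = NonUnitalStarAlgHom.id ℂ (CubicalAlgebra φ) := by
    refine cubicalHom_ext (fun v => ?_) fun v w e => ?_
    · rw [← univPath_id]
      exact hFG' _
    · rw [← univPath_edge]
      exact hFG' _
  have hbij : Function.Bijective F := Function.bijective_iff_has_inverse.2
    ⟨G, fun x => DFunLike.congr_fun hGF x, fun x => DFunLike.congr_fun hFG x⟩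
  exact ⟨StarAlgEquiv.ofBijective F hbij, hF⟩

end Representations

end KGraph

/-! ### The main theorem. -/

theorem mainTheorem11 {k : ℕ} {V : Type u} [SmallCategory V] [KGraph k V]
    (hrow : KGraph.RowFinite V) (hsrc : KGraph.NoSources V)
    (φ : KGraph.Cube V 2 → Circle) (hφ : KGraph.IsCubicalCocycle φ) :
    -- the generators of `C⋆_φ(Λ)` form a universal Cuntz–Krieger `φ`-representation
    KGraph.IsCKRep φ (KGraph.univVertex φ) (KGraph.univEdge φ) ∧
    (∀ (B : Type w) [NonUnitalCStarAlgebra B] (p : V → B)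
      (s : ∀ ⦃v w : V⦄, KGraph.Edge v w → B), KGraph.IsCKRep φ p s →
      ∃! π : KGraph.CubicalAlgebra φ →⋆ₙₐ[ℂ] B,
        (∀ v : V, π (KGraph.univVertex φ v) = p v) ∧
        ∀ ⦃v w : V⦄ (e : KGraph.Edge v w), π (KGraph.univEdge φ e) = s e) ∧
    -- `c_φ` is a categorical `2`-cocycle
    KGraph.IsCatCocycle2 (KGraph.catCocycle φ) ∧
    -- products along preferred factorisations form a Cuntz–Krieger `(Λ, c_φ)`-family
    KGraph.IsCKFamily (KGraph.catCocycle φ) (KGraph.univPath φ) ∧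
    -- this family is universal
    (∀ (B : Type w) [NonUnitalCStarAlgebra B] (t' : KGraph.Fun1 V B),
      KGraph.IsCKFamily (KGraph.catCocycle φ) t' →
      ∃! π : KGraph.CubicalAlgebra φ →⋆ₙₐ[ℂ] B,
        ∀ ⦃v w : V⦄ (f : v ⟶ w), π (KGraph.univPath φ f) = t' f) ∧
    -- hence `C⋆(Λ, c_φ) ≅ C⋆_φ(Λ)`, compatibly with the generators
    (∃ e : KGraph.CatAlgebra (KGraph.catCocycle φ) ≃⋆ₐ[ℂ] KGraph.CubicalAlgebra φ,
      ∀ ⦃v w : V⦄ (f : v ⟶ w),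
        e (KGraph.univElement (KGraph.catCocycle φ) f) = KGraph.univPath φ f) ∧
    -- and `C⋆(Λ, c) ≅ C⋆_φ(Λ)` for each `2`-cocycle `c = (δ¹b) c_φ` cohomologous to `c_φ`
    (∀ c : KGraph.Fun2 V Circle, KGraph.IsCatCocycle2 c →
      ∀ b : KGraph.Fun1 V Circle, KGraph.IsCochain1 b →
        (∀ ⦃x y z : V⦄ (μ : x ⟶ y) (ν : y ⟶ z),
          c μ ν = KGraph.coboundary1 b μ ν * KGraph.catCocycle φ μ ν) →
        ∃ e : KGraph.CatAlgebra c ≃⋆ₐ[ℂ] KGraph.CubicalAlgebra φ,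
          ∀ ⦃v w : V⦄ (f : v ⟶ w),
            e (KGraph.univElement c f) = (b f : ℂ) • KGraph.univPath φ f) := by
  refine ⟨KGraph.isCKRep_univ hrow φ, fun B _ p s h => ?_, hφ.isCatCocycle2,
    (KGraph.isCKRep_univ hrow φ).isCKFamily hrow hsrc,
    fun B _ t' h => KGraph.existsUnique_cubicalHom hrow hφ h, ?_,
    fun c _ b hb hc => KGraph.exists_equiv_of_cohomologous hrow hsrc hφ hb hc⟩
  · obtain ⟨π, hp, hs⟩ := KGraph.exists_cubicalHom hrow h
    exact ⟨π, ⟨hp, hs⟩, fun ψ hψ => KGraph.cubicalHom_ext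
      (fun v => (hψ.1 v).trans (hp v).symm) fun v w e => (hψ.2 e).trans (hs e).symm⟩
  -- The isomorphism for `c_φ` itself is the case of the trivial cochain `b = 1`.
  · obtain ⟨e, he⟩ := KGraph.exists_equiv_of_cohomologous hrow hsrc hφ
      (c := KGraph.catCocycle φ) (b := fun _ _ _ => 1) (fun _ => rfl)
      (fun x y z μ ν => by simp [KGraph.coboundary1])
    exact ⟨e, fun v w f => by simpa using he f⟩
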